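/- Let $p$ be an odd prime, $n\ge 2$, let $L/K$ be a separable field extension of degree $p^n$, $\widetilde L$ its normal closure and $G=\mathrm{Gal}(\widetilde L/K)$. A Hopf Galois structure on $L/K$ is a pair $(H,\mu)$, where $H$ is a finite-dimensional cocommutative $K$-Hopf algebra and $\mu:H\to \mathrm{End}_K(L)$ is a $K$-algebra morphism making $L$ a left $H$-module algebra (that is, $\mu(h)(xy)=\sum \mu(h_{(1)})(x)\,\mu(h_{(2)})(y)$ and $\mu(h)(1)=\varepsilon(h)1$) such that the $K$-linear map $L\otimes_K H\to \mathrm{End}_K(L)$, $x\otimes h\mapsto (y\mapsto x\,\mu(h)(y))$, is bijective. Two Hopf Galois structures on $L/K$ are isomorphic if there is an isomorphism of $K$-Hopf algebras between them that commutes with the actions on $L$. A Hopf Galois structure $(H,\mu)$ is of type $N$, for a group $N$, if $\widetilde L\otimes_K H\cong \widetilde L[N]$ as $\widetilde L$-Hopf algebras; it is of cyclic type if it is of type $C_{p^n}$, the cyclic group of order $p^n$. Then the number of isomorphism classes of Hopf Galois structures of cyclic type on $L/K$ is 1. $p^{n-1}$ if $L/K$ is a Galois extension with cyclic Galois group; 2.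 $1$ if $G$ is isomorphic to a semidirect product $C_{p^n}\rtimes C_D$ of the cyclic group of order $p^n$ by a cyclic group of order $D$, where $D>1$ is a divisor of $p-1$. -/

import Mathlib

open scoped TensorProduct

universe u v w

/-- The `K`-linear map `L ⊗[K] H → End_K(L)` induced by an algebra morphism `μ : H → End_K(L)`:
it sends `x ⊗ h` to the endomorphism `y ↦ x * μ h y`. -/
noncomputable def hopfGaloisMap (K : Type u) (L : Type v) [Field K] [Field L] [Algebra K L]
    (H : Type u) [Ring H] [Algebra K H] (μ : H →ₐ[K] Module.End K L) :
    L ⊗[K] H →ₗ[K] Module.End K L :=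
  TensorProduct.lift
    ((LinearMap.mul K (Module.End K L)).compl₁₂ (Algebra.lmul K L).toLinearMap μ.toLinearMap)

/-- A Hopf Galois structure on `L/K`: a finite cocommutative `K`-Hopf algebra `H` together with
a Hopf action `μ : H → End_K(L)`, i.e. `μ` makes `L` a left `H`-module algebra and induces a
bijection `L ⊗[K] H → End_K(L)`.
As `H` is finite dimensional over `K`, taking it in the universe of `K` loses nothing up to
isomorphism. -/
structure HopfGaloisStructure (K : Type u) (L : Type v) [Field K] [Field L] [Algebra K L] where
  /-- the Hopf algebra -/
  H : Type u
  [ring : Ring H]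
  [hopf : HopfAlgebra K H]
  [cocomm : Coalgebra.IsCocomm K H]
  [finite : Module.Finite K H]
  /-- the action -/
  μ : H →ₐ[K] Module.End K L
  /-- `h • (x * y) = ∑ (h₁ • x) * (h₂ • y)`, where `Δ h = ∑ h₁ ⊗ h₂` -/
  act_mul : ∀ (h : H) (x y : L),
    μ h (x * y) = LinearMap.mul' K L
      (TensorProduct.map (μ.toLinearMap.flip x) (μ.toLinearMap.flip y) (Coalgebra.comul (R := K) h))
  /-- `h • 1 = ε(h) 1` -/
  act_one : ∀ h : H, μ h 1 = algebraMap K L (Coalgebra.counit (R := K) h)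
  bijective : Function.Bijective (hopfGaloisMap K L H μ)

attribute [instance] HopfGaloisStructure.ring HopfGaloisStructure.hopf
  HopfGaloisStructure.cocomm HopfGaloisStructure.finite

namespace HopfGaloisStructure

/-- Isomorphism of Hopf Galois structures: an isomorphism of Hopf algebras that commutes with
the actions on `L`. (A bialgebra isomorphism automatically respects the antipodes.) -/
def Iso {K : Type u} {L : Type v} [Field K] [Field L] [Algebra K L]
    (S T : HopfGaloisStructure K L) : Prop :=
  ∃ e : S.H ≃ₐc[K] T.H, ∀ h : S.H, T.μ (e h) = S.μ h

theorem iso_equivalence (K : Type u) (L : Type v) [Field K] [Field L] [Algebra K L] :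
    Equivalence (Iso (K := K) (L := L)) where
  refl S := ⟨BialgEquiv.refl K S.H, fun _ => rfl⟩
  symm := fun ⟨e, he⟩ => ⟨e.symm, fun h => by
    rw [← he, BialgEquiv.apply_symm_apply]⟩
  trans := fun ⟨e, he⟩ ⟨f, hf⟩ => ⟨e.trans f, fun h => by
    rw [← he h, ← hf (e h)]; rfl⟩

instance setoid (K : Type u) (L : Type v) [Field K] [Field L] [Algebra K L] :
    Setoid (HopfGaloisStructure K L) :=
  ⟨Iso, iso_equivalence K L⟩

/-- Let `E` be a normal closure of the separable extension `L/K`. A Hopf Galois structure on `L/K`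
with Hopf algebra `H` is of type `N` if `E ⊗[K] H` and the group algebra `E[N]` are isomorphic as
Hopf algebras over `E`, i.e. `H` is an `E`-form of the group algebra of `N`. -/
def IsOfType {K : Type u} {L : Type v} [Field K] [Field L] [Algebra K L]
    (S : HopfGaloisStructure K L) (E : Type w) [Field E] [Algebra K E]
    (N : Type*) [Group N] : Prop :=
  Nonempty ((E ⊗[K] S.H) ≃ₐc[E] MonoidAlgebra E N)

/-- The number of isomorphism classes of Hopf Galois structures of type `N` on `L/K`, where `E` is
a normal closure of `L/K`. -/
noncomputable def numberOfType (K : Type u) (L : Type v) [Field K] [Field L] [Algebra K L]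
    (E : Type w) [Field E] [Algebra K E] (N : Type*) [Group N] : ℕ :=
  Nat.card {c : Quotient (setoid K L) //
    ∃ S : HopfGaloisStructure K L, Quotient.mk (setoid K L) S = c ∧ S.IsOfType E N}

end HopfGaloisStructure

/-! The proof reduces the count to permutation groups, in the manner of Greither and Pareigis. Let
`E` be the normal closure and `X` the set of `K`-embeddings of `L` into `E`, on which the Galois
group acts faithfully and transitively. The space `Hom_K(L, E)` has `X` as an `E`-basis, and `E ⊗ H`
acts on it by precomposition. If `E ⊗ H ≅ E[N]` with `N` abelian, the group-like elements send
algebra maps to algebra maps, so `N` permutes `X`. Bijectivity of the Galois map makes this action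
regular (`permHom_bijective`), and the Galois action on `E ⊗ H` makes the image of `N` stable under
conjugation.

Conversely, a regular group stable under conjugation gives a semilinear Galois action on `E[N]`. By
descent its invariants form a `K`-Hopf algebra, which acts on `L` viewed as the equivariant
functions `X → E` (`exists_permHom_eq`). The permutation group and the structure up to isomorphism
determine each other, whence `numberOfType_eq_ncard`.

It remains to count regular cyclic subgroups `P` of order `p ^ n` normalised by the Galois group. A
transitive `σ` normalising `P` acts on it by `ν ↦ ν ^ a`. If `η ∈ P` agrees with `σ` at `x`, then `σ
^ i x = η ^ (1 + a + ... + a ^ (i - 1)) x`, so `a` determines `P`. Lifting the exponent shows that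
for `p` odd and `a ≡ 1` mod `p` these sums represent each residue mod `p ^ n` once, so every such
`a` occurs. If `σ` generates the Galois group, the order of `σ` forces `a ≡ 1` mod `p`, which leaves
`p ^ (n - 1)` residues. In the semidirect case the complement conjugates `σ` to `σ ^ u` with `u` not
`1` mod `p`. Then `a ^ u = a` while `a` has `p`-power order, so `a = 1` and only `P = ⟨σ⟩` survives.
-/

namespace HopfGaloisStructure

/-! ### The action of `E ⊗ H` on `Hom_K(L, E)` and its group-like elements -/

section Action

variable {K : Type u} {L : Type v} {E : Type w} [Field K] [Field L] [Field E]
  [Algebra K L] [Algebra K E]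

/-- The right action of `E ⊗[K] H` on `Hom_K(L, E)`: it sends `f` to `e • (f ∘ μ h)`
under `e ⊗ h`. -/
noncomputable def precomp (S : HopfGaloisStructure K L) (f : L →ₗ[K] E) :
    E ⊗[K] S.H →ₗ[E] (L →ₗ[K] E) :=
  LinearMap.liftBaseChange E ((LinearMap.compRight K f) ∘ₗ S.μ.toLinearMap)

variable (S : HopfGaloisStructure K L)

@[simp] lemma precomp_tmul (f : L →ₗ[K] E) (e : E) (h : S.H) :
    S.precomp f (e ⊗ₜ h) = e • (f ∘ₗ S.μ h) := by
  simp [precomp]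

lemma precomp_tmul_apply (f : L →ₗ[K] E) (e : E) (h : S.H) (a : L) :
    S.precomp f (e ⊗ₜ h) a = e * f (S.μ h a) := by
  simp

lemma precomp_one (f : L →ₗ[K] E) : S.precomp f 1 = f := by
  rw [Algebra.TensorProduct.one_def]
  ext a
  simp

lemma precomp_mul (f : L →ₗ[K] E) (z w : E ⊗[K] S.H) :
    S.precomp f (z * w) = S.precomp (S.precomp f z) w := by
  induction z with
  | zero =>
    have : ∀ w, S.precomp (0 : L →ₗ[K] E) w = 0 := by
      intro w
      induction w with
      | zero => simp
      | tmul e h => simp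
      | add a b ha hb => simp [ha, hb]
    simp [this]
  | add a b ha hb =>
    have : ∀ (f g : L →ₗ[K] E) w, S.precomp (f + g) w = S.precomp f w + S.precomp g w := by
      intro f g w
      induction w with
      | zero => simp
      | tmul e h => simp [LinearMap.add_comp]
      | add a b ha hb => simp only [map_add, ha, hb]; abel
    simp only [add_mul, map_add, ha, hb, this]
  | tmul e h =>
    induction w with
    | zero => simp
    | add a b ha hb => simp only [mul_add, map_add, ha, hb]
    | tmul e' h' =>
      ext a
      simp [mul_assoc, mul_left_comm]

lemma algHom_comp_precomp (g : E →ₐ[K] E) (f : L →ₗ[K] E) (z : E ⊗[K] S.H) :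
    g.toLinearMap ∘ₗ S.precomp f z =
      S.precomp (g.toLinearMap ∘ₗ f) (g.toLinearMap.rTensor S.H z) := by
  induction z with
  | zero => simp
  | tmul e h => ext a; simp
  | add a b ha hb => simp only [map_add, LinearMap.comp_add, ha, hb]

lemma precomp_apply_one (x : L →ₐ[K] E) (z : E ⊗[K] S.H) :
    S.precomp x.toLinearMap z 1 = Coalgebra.counit (R := E) z := by
  induction z with
  | zero => simp
  | tmul e h => simp [S.act_one, Algebra.smul_def, mul_comm]
  | add a b ha hb => simp only [map_add, LinearMap.add_apply, ha, hb]

lemma precomp_apply_mul (x : L →ₐ[K] E) (z : E ⊗[K] S.H) (a b : L) :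
    S.precomp x.toLinearMap z (a * b) =
      LinearMap.mul' E E (TensorProduct.map
        (LinearMap.applyₗ' E a ∘ₗ S.precomp x.toLinearMap)
        (LinearMap.applyₗ' E b ∘ₗ S.precomp x.toLinearMap) (Coalgebra.comul (R := E) z)) := by
  induction z with
  | zero => simp
  | add a b ha hb => simp only [map_add, LinearMap.add_apply, ha, hb]
  | tmul e h =>
    rw [precomp_tmul_apply, AlgHom.toLinearMap_apply, S.act_mul, TensorProduct.comul_tmul,
      CommSemiring.comul_apply]
    generalize Coalgebra.comul (R := K) h = t
    induction t with
    | zero => simp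
    | add a b ha hb => simp only [map_add, mul_add, TensorProduct.tmul_add, ha, hb]
    | tmul h₁ h₂ => simp [mul_left_comm]

lemma finrank_hopfAlgebra [FiniteDimensional K L] :
    Module.finrank K S.H = Module.finrank K L := by
  have h := (LinearEquiv.ofBijective _ S.bijective).finrank_eq
  rw [Module.finrank_tensorProduct, Module.finrank_linearMap] at h
  exact Nat.eq_of_mul_eq_mul_left Module.finrank_pos h

/-- Since `x` is multiplicative, a factor `l ∈ L` comes out as the scalar `x l ∈ E`. -/
lemma comp_hopfGaloisMap_mem_range (x : L →ₐ[K] E) (t : L ⊗[K] S.H) :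
    x.toLinearMap ∘ₗ hopfGaloisMap K L S.H S.μ t ∈ (S.precomp x.toLinearMap).range := by
  induction t with
  | zero => simp
  | add a b ha hb => rw [map_add, LinearMap.comp_add]; exact add_mem ha hb
  | tmul l h => exact ⟨x l ⊗ₜ h, by ext a; simp [hopfGaloisMap]⟩

/-- The maps `x ∘ ψ` with `ψ ∈ End_K(L)` span `Hom_K(L, E)` over `E`, and each `ψ` lies in the image
of the Galois map. -/
lemma precomp_surjective [FiniteDimensional K L] (x : L →ₐ[K] E) :
    Function.Surjective (S.precomp x.toLinearMap) := by
  rw [← LinearMap.range_eq_top, eq_top_iff]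
  intro f _
  let b := Module.finBasis K L
  have hf : f = ∑ i, f (b i) • (x.toLinearMap ∘ₗ (b.coord i).smulRight (1 : L)) := by
    refine b.ext fun j => ?_
    simp [LinearMap.sum_apply, Finsupp.single_apply, apply_ite]
  rw [hf]
  refine Submodule.sum_mem _ fun i _ => Submodule.smul_mem _ _ ?_
  obtain ⟨t, ht⟩ := S.bijective.2 ((b.coord i).smulRight (1 : L))
  rw [← ht]
  exact S.comp_hopfGaloisMap_mem_range x t

lemma precomp_bijective [FiniteDimensional K L] (x : L →ₐ[K] E) :
    Function.Bijective (S.precomp x.toLinearMap) := by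
  refine ⟨(LinearMap.injective_iff_surjective_of_finrank_eq_finrank ?_).2
    (S.precomp_surjective x), S.precomp_surjective x⟩
  rw [Module.finrank_baseChange, finrank_hopfAlgebra, Module.finrank_linearMap]
  simp

/-- The family of the maps `S.precomp x`, where `x` runs through the `K`-embeddings of `L`. -/
noncomputable def act (E : Type w) [Field E] [Algebra K E] :
    E ⊗[K] S.H →ₗ[E] ((L →ₐ[K] E) → L →ₗ[K] E) :=
  LinearMap.pi fun x => S.precomp x.toLinearMap

@[simp] lemma act_apply (z : E ⊗[K] S.H) (x : L →ₐ[K] E) :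
    S.act E z x = S.precomp x.toLinearMap z := rfl

lemma act_injective [FiniteDimensional K L] [Nonempty (L →ₐ[K] E)] :
    Function.Injective (S.act E) := by
  intro z w h
  obtain ⟨x⟩ := ‹Nonempty (L →ₐ[K] E)›
  exact (S.precomp_bijective x).1 (congrFun h x)

section GroupLike

variable {N : Type*} [CommGroup N] (Φ : (E ⊗[K] S.H) ≃ₐc[E] MonoidAlgebra E N)

lemma counit_symm_single (n : N) :
    Coalgebra.counit (R := E) (Φ.symm (MonoidAlgebra.single n 1)) = 1 :=
  ((MonoidAlgebra.isGroupLikeElem_single_one (R := E) (A := E) n).map Φ.symm).counit_eq_one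

lemma comul_symm_single (n : N) :
    Coalgebra.comul (R := E) (Φ.symm (MonoidAlgebra.single n 1)) =
      Φ.symm (MonoidAlgebra.single n 1) ⊗ₜ Φ.symm (MonoidAlgebra.single n 1) :=
  ((MonoidAlgebra.isGroupLikeElem_single_one (R := E) (A := E) n).map Φ.symm).comul_eq_tmul_self

/-- Group-like elements of `E ⊗[K] H` permute the embeddings of `L`. -/
noncomputable def translate (n : N) (x : L →ₐ[K] E) : L →ₐ[K] E :=
  AlgHom.ofLinearMap (S.precomp x.toLinearMap (Φ.symm (MonoidAlgebra.single n 1)))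
    (by rw [precomp_apply_one, counit_symm_single])
    (fun a b => by rw [precomp_apply_mul, comul_symm_single]; simp)

lemma toLinearMap_translate (n : N) (x : L →ₐ[K] E) :
    (S.translate Φ n x).toLinearMap =
      S.precomp x.toLinearMap (Φ.symm (MonoidAlgebra.single n 1)) := by
  ext a; rfl

lemma translate_one (x : L →ₐ[K] E) : S.translate Φ 1 x = x := by
  apply AlgHom.toLinearMap_injective
  rw [toLinearMap_translate, ← MonoidAlgebra.one_def, map_one, precomp_one]

/-- Precomposition reverses products; commutativity of `N` turns the right action into a left one.
-/
lemma translate_mul (m n : N) (x : L →ₐ[K] E) :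
    S.translate Φ (m * n) x = S.translate Φ m (S.translate Φ n x) := by
  apply AlgHom.toLinearMap_injective
  rw [toLinearMap_translate, toLinearMap_translate, toLinearMap_translate, ← precomp_mul,
    ← map_mul, MonoidAlgebra.single_mul_single, one_mul, mul_comm]

/-- The permutation representation of `N` on the embeddings of `L` attached to a Hopf Galois
structure of type `N`. -/
noncomputable def permHom : N →* Equiv.Perm (L →ₐ[K] E) :=
  letI : MulAction N (L →ₐ[K] E) :=
    { smul := S.translate Φ
      one_smul := S.translate_one Φ
      mul_smul := S.translate_mul Φ }
  MulAction.toPermHom N (L →ₐ[K] E)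

lemma permHom_apply (n : N) (x : L →ₐ[K] E) :
    (S.permHom Φ n x).toLinearMap =
      S.precomp x.toLinearMap (Φ.symm (MonoidAlgebra.single n 1)) :=
  S.toLinearMap_translate Φ n x

end GroupLike

end Action

end HopfGaloisStructure

/-! ### Galois-fixed vectors in a base change -/

section Descent

variable {K E M V : Type*} [Field K] [Field E] [Algebra K E] [FiniteDimensional K E] [IsGalois K E]
  [AddCommGroup M] [Module K M] [Module.Finite K M]
  [AddCommGroup V] [Module K V] [Module E V] [IsScalarTower K E V]

/-- In a basis coming from `M`, the Galois group acts on coordinates alone, so a fixed vector has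
fixed coordinates, and these lie in `K`. -/
lemma IsBaseChange.exists_eq_of_fixed {ι : M →ₗ[K] V} (hι : IsBaseChange E ι)
    (ρ : Gal(E/K) → V →+ V) (hsmul : ∀ g (e : E) v, ρ g (e • v) = g e • ρ g v)
    (hfix : ∀ g m, ρ g (ι m) = ι m) {v : V} (hv : ∀ g, ρ g v = v) : ∃ m, ι m = v := by
  let b := Module.finBasis K M
  let b' : Module.Basis _ E V := (b.baseChange E).map hι.equiv
  have hb' : ∀ i, b' i = ι (b i) := fun i => by simp [b', hι.equiv_tmul]
  have hsum : v = ∑ i, b'.repr v i • ι (b i) := by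
    conv_lhs => rw [← b'.sum_repr v]
    simp only [hb']
  have hcoord : ∀ i, ∃ k : K, algebraMap K E k = b'.repr v i := by
    intro i
    refine (IsGalois.mem_range_algebraMap_iff_fixed (F := K) (E := E) _).2 fun g => ?_
    have h1 : v = ∑ i, g (b'.repr v i) • b' i := by
      conv_lhs => rw [← hv g, hsum]
      simp [hsmul, hfix, hb']
    have h2 := congrArg (fun w => b'.repr w i) h1
    simpa [Finsupp.single_apply] using h2.symm
  choose k hk using hcoord
  refine ⟨∑ i, k i • b i, ?_⟩
  rw [hsum, map_sum]
  refine Finset.sum_congr rfl fun i _ => ?_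
  rw [map_smul, ← hk, algebraMap_smul]

end Descent

/-! ### The Galois group acting on the embeddings of `L` -/

section Embeddings

variable (K : Type u) (L : Type v) (E : Type w) [Field K] [Field L] [Field E]
  [Algebra K L] [Algebra K E]

/-- The action of the Galois group of `E/K` on the `K`-embeddings of `L` into `E`. -/
noncomputable def galPerm : Gal(E/K) →* Equiv.Perm (L →ₐ[K] E) :=
  letI : MulAction Gal(E/K) (L →ₐ[K] E) :=
    { smul g x := (g : E →ₐ[K] E).comp x
      one_smul _ := rfl
      mul_smul _ _ _ := rfl }
  MulAction.toPermHom Gal(E/K) (L →ₐ[K] E)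

variable {K L E}

@[simp] lemma galPerm_apply (g : Gal(E/K)) (x : L →ₐ[K] E) :
    galPerm K L E g x = (g : E →ₐ[K] E).comp x := rfl

lemma galPerm_inv_apply (g : Gal(E/K)) (x : L →ₐ[K] E) :
    (galPerm K L E g)⁻¹ x = ((g⁻¹ : Gal(E/K)) : E →ₐ[K] E).comp x := by
  rw [← map_inv, galPerm_apply]

lemma card_algHom_of_isNormalClosure [FiniteDimensional K L] [Algebra.IsSeparable K L]
    [h : IsNormalClosure K L E] : Nat.card (L →ₐ[K] E) = Module.finrank K L := by
  rw [Nat.card_eq_fintype_card, AlgHom.card_of_splits K L E h.splits]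

lemma nonempty_algHom_of_isNormalClosure [FiniteDimensional K L] [Algebra.IsSeparable K L]
    [h : IsNormalClosure K L E] : Nonempty (L →ₐ[K] E) :=
  (Nat.card_pos_iff.1 ((card_algHom_of_isNormalClosure (K := K) (L := L) (E := E)).symm ▸
    Module.finrank_pos)).1

lemma exists_comp_eq [IsNormalClosure K L E] [FiniteDimensional K L] (x y : L →ₐ[K] E) :
    ∃ g : Gal(E/K), galPerm K L E g x = y := by
  have : Normal K E := IsNormalClosure.normal (K := L)
  let e : x.fieldRange ≃ₐ[K] y.fieldRange :=
    (AlgEquiv.ofInjectiveField x).symm.trans (AlgEquiv.ofInjectiveField y)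
  refine ⟨e.liftNormal E, ?_⟩
  ext a
  have h := e.liftNormal_commutes E (AlgEquiv.ofInjectiveField x a)
  have h2 : e (AlgEquiv.ofInjectiveField x a) = AlgEquiv.ofInjectiveField y a :=
    congrArg (AlgEquiv.ofInjectiveField y) ((AlgEquiv.ofInjectiveField x).symm_apply_apply a)
  rw [h2] at h
  exact h

lemma isGalois_of_isNormalClosure [FiniteDimensional K L] [Algebra.IsSeparable K L]
    [IsNormalClosure K L E] : IsGalois K E := by
  have hn : Normal K E := IsNormalClosure.normal (K := L)
  have htop := (Algebra.IsAlgebraic.isNormalClosure_iff.1 ‹IsNormalClosure K L E›).2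
  have hsep : Algebra.IsSeparable K (⊤ : IntermediateField K E) := by
    rw [← htop, normalClosure_def]
    have : ∀ f : L →ₐ[K] E, Algebra.IsSeparable K f.fieldRange := fun f =>
      Algebra.IsSeparable.of_algHom K L (AlgEquiv.ofInjectiveField f).symm.toAlgHom
    infer_instance
  have : Algebra.IsSeparable K E :=
    Algebra.IsSeparable.of_algHom K _ (IntermediateField.topEquiv (F := K) (E := E)).symm.toAlgHom
  exact ⟨⟩

lemma finiteDimensional_of_isNormalClosure [FiniteDimensional K L]
    [IsNormalClosure K L E] : FiniteDimensional K E := by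
  have htop := (Algebra.IsAlgebraic.isNormalClosure_iff.1 ‹IsNormalClosure K L E›).2
  have : FiniteDimensional K (IntermediateField.normalClosure K L E) := inferInstance
  rw [htop] at this
  exact Module.Finite.equiv (IntermediateField.topEquiv (F := K) (E := E)).toLinearEquiv

/-- The value at `x` is fixed by everything fixing `x(L)` pointwise, hence lies in `x(L)` by Galois
theory; transitivity carries the preimage to all other embeddings. This identifies `L` with the
equivariant functions on embeddings. -/
lemma exists_apply_eq_of_equivariant [FiniteDimensional K L] [Algebra.IsSeparable K L]
    [IsNormalClosure K L E] (f : (L →ₐ[K] E) → E)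
    (hf : ∀ (g : Gal(E/K)) x, f (galPerm K L E g x) = g (f x)) :
    ∃ a : L, ∀ x, f x = x a := by
  have := isGalois_of_isNormalClosure (K := K) (L := L) (E := E)
  have := finiteDimensional_of_isNormalClosure (K := K) (L := L) (E := E)
  obtain ⟨x⟩ := nonempty_algHom_of_isNormalClosure (K := K) (L := L) (E := E)
  have hx : f x ∈ x.fieldRange := by
    rw [← IsGalois.fixedField_fixingSubgroup x.fieldRange, IntermediateField.mem_fixedField_iff]
    intro g hg
    rw [← hf]
    congr 1
    ext a
    exact (IntermediateField.mem_fixingSubgroup_iff _ _).1 hg (x a) ⟨a, rfl⟩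
  obtain ⟨a, ha⟩ := hx
  refine ⟨a, fun y => ?_⟩
  obtain ⟨g, rfl⟩ := exists_comp_eq x y
  rw [hf, ← ha]
  rfl

end Embeddings

/-- A group `N` of permutations of a set is regular. -/
def Subgroup.IsRegular {X : Type*} (N : Subgroup (Equiv.Perm X)) : Prop :=
  ∀ x : X, Function.Bijective fun n : N => (n : Equiv.Perm X) x

/-! ### From Hopf Galois structures to regular permutation groups -/

namespace HopfGaloisStructure
variable {K : Type u} {L : Type v} {E : Type w} [Field K] [Field L] [Field E]
  [Algebra K L] [Algebra K E] (S T : HopfGaloisStructure K L)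

section PermHom

variable {N : Type*} [CommGroup N] (Φ : (E ⊗[K] S.H) ≃ₐc[E] MonoidAlgebra E N)

lemma act_symm_single (n : N) :
    S.act E (Φ.symm (MonoidAlgebra.single n 1)) = fun x => (S.permHom Φ n x).toLinearMap := by
  ext1 x; rw [act_apply, permHom_apply]

lemma range_act_eq_span :
    (S.act E).range = Submodule.span E
      ((fun (π : Equiv.Perm (L →ₐ[K] E)) x => (π x).toLinearMap) '' (S.permHom Φ).range) := by
  have h1 : (S.act E).range =
      ((S.act E) ∘ₗ (Φ.symm.toLinearEquiv : MonoidAlgebra E N →ₗ[E] _)).range :=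
    (LinearMap.range_comp_of_range_eq_top _ (LinearEquiv.range _)).symm
  have h2 : (⊤ : Submodule E (MonoidAlgebra E N)) =
      Submodule.span E (Set.range fun n : N => MonoidAlgebra.single n (1 : E)) := by
    rw [eq_comm, eq_top_iff]
    intro z _
    induction z using MonoidAlgebra.induction_linear with
    | zero => exact zero_mem _
    | add a b ha hb => exact add_mem (ha trivial) (hb trivial)
    | single n e =>
      have : MonoidAlgebra.single n e = e • MonoidAlgebra.single n (1 : E) := by simp
      rw [this]
      exact Submodule.smul_mem _ _ (Submodule.subset_span ⟨n, rfl⟩)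
  rw [h1, LinearMap.range_eq_map, h2, Submodule.map_span, ← Set.range_comp, MonoidHom.coe_range,
    ← Set.range_comp]
  congr 2

variable [FiniteDimensional K L] [Algebra.IsSeparable K L] [IsNormalClosure K L E]

/-- Distinct group-like elements stay distinct under the bijection `S.precomp x`, and both sides
have `[L : K]` elements. -/
lemma permHom_bijective (x : L →ₐ[K] E) : Function.Bijective fun n => S.permHom Φ n x := by
  have hinj : Function.Injective fun n => S.permHom Φ n x := by
    intro m n h
    have h1 : (S.permHom Φ m x).toLinearMap = (S.permHom Φ n x).toLinearMap :=
      congrArg AlgHom.toLinearMap h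
    rw [permHom_apply, permHom_apply] at h1
    exact MonoidAlgebra.single_left_injective one_ne_zero
      (Φ.symm.injective ((S.precomp_bijective x).1 h1))
  have : Finite N := Finite.of_injective _ hinj
  have := Fintype.ofFinite N
  refine (Nat.bijective_iff_injective_and_card _).2 ⟨hinj, ?_⟩
  have := Φ.toLinearEquiv.finrank_eq
  rw [Module.finrank_baseChange, finrank_hopfAlgebra,
    (MonoidAlgebra.coeffLinearEquiv E).finrank_eq, Module.finrank_finsupp_self] at this
  rw [card_algHom_of_isNormalClosure, this, Nat.card_eq_fintype_card]

lemma permHom_injective : Function.Injective (S.permHom Φ) := by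
  obtain ⟨x⟩ := nonempty_algHom_of_isNormalClosure (K := K) (L := L) (E := E)
  exact fun m n h => (S.permHom_bijective Φ x).1 (congrArg (fun π => π x) h)

lemma isRegular_range_permHom : (S.permHom Φ).range.IsRegular := by
  intro x
  have h := S.permHom_bijective Φ x
  refine ⟨?_, fun y => ?_⟩
  · rintro ⟨_, m, rfl⟩ ⟨_, n, rfl⟩ hmn
    obtain rfl := h.1 hmn
    rfl
  · obtain ⟨n, hn⟩ := h.2 y
    exact ⟨⟨_, n, rfl⟩, hn⟩

/-- The right-hand side does not mention `Φ`, so the permutation group depends on `S` alone. An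
element of `E ⊗ H` is determined by its effect on one embedding, so one inducing a permutation must
be group-like. -/
lemma mem_range_permHom_iff (π : Equiv.Perm (L →ₐ[K] E)) :
    π ∈ (S.permHom Φ).range ↔ (fun x => (π x).toLinearMap) ∈ (S.act E).range := by
  constructor
  · rintro ⟨n, rfl⟩
    exact ⟨_, S.act_symm_single Φ n⟩
  · rintro ⟨z, hz⟩
    obtain ⟨x⟩ := nonempty_algHom_of_isNormalClosure (K := K) (L := L) (E := E)
    obtain ⟨n, hn⟩ := (S.permHom_bijective Φ x).2 (π x)
    have hz' : z = Φ.symm (MonoidAlgebra.single n 1) := by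
      apply (S.precomp_bijective x).1
      rw [← permHom_apply, ← act_apply, hz]
      exact congrArg AlgHom.toLinearMap hn.symm
    refine ⟨n, Equiv.ext fun y => AlgHom.toLinearMap_injective ?_⟩
    rw [permHom_apply, ← hz', ← act_apply, hz]

lemma galPerm_conj_mem_range_permHom (g : Gal(E/K)) {π : Equiv.Perm (L →ₐ[K] E)}
    (hπ : π ∈ (S.permHom Φ).range) :
    galPerm K L E g * π * (galPerm K L E g)⁻¹ ∈ (S.permHom Φ).range := by
  obtain ⟨n, rfl⟩ := hπ
  rw [mem_range_permHom_iff]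
  -- Conjugation by `g` on permutations corresponds to applying `g` to the scalars of `E ⊗ H`.
  refine ⟨(g : E →ₐ[K] E).toLinearMap.rTensor S.H (Φ.symm (MonoidAlgebra.single n 1)), ?_⟩
  ext1 x
  have h : x.toLinearMap =
      (g : E →ₐ[K] E).toLinearMap ∘ₗ ((galPerm K L E g)⁻¹ x).toLinearMap := by
    rw [galPerm_inv_apply]
    ext a
    exact (g.apply_symm_apply (x a)).symm
  rw [act_apply, h, ← algHom_comp_precomp, ← permHom_apply]
  rfl

end PermHom

/-! ### Recovering a structure from its permutation group -/

section Iso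

lemma Iso.range_act_eq {S T : HopfGaloisStructure K L} (h : S.Iso T) :
    (S.act E).range = (T.act E).range := by
  obtain ⟨e, he⟩ := h
  have hcomp : S.act E = T.act E ∘ₗ
      (e.toLinearEquiv.baseChange K E S.H T.H : E ⊗[K] S.H →ₗ[E] E ⊗[K] T.H) := by
    refine LinearMap.ext fun z => ?_
    induction z with
    | zero => simp
    | add a b ha hb => simp only [map_add, ha, hb]
    | tmul a h =>
      ext x b
      simp only [act_apply, precomp_tmul, ← he h]
      rfl
  rw [hcomp]
  exact LinearMap.range_comp_of_range_eq_top _ (LinearEquiv.range _)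

variable [FiniteDimensional K L] [Algebra.IsSeparable K L] [IsNormalClosure K L E]

/-- If `z ∈ E ⊗ H` induces `φ`, then so does every Galois conjugate of `z`, because `φ` is defined
over `K`. By faithfulness `z` is fixed, hence comes from `H`. -/
lemma mem_range_μ_iff (φ : Module.End K L) :
    φ ∈ S.μ.range ↔ (fun x : L →ₐ[K] E => x.toLinearMap ∘ₗ φ) ∈ (S.act E).range := by
  have := isGalois_of_isNormalClosure (K := K) (L := L) (E := E)
  have := finiteDimensional_of_isNormalClosure (K := K) (L := L) (E := E)
  have := nonempty_algHom_of_isNormalClosure (K := K) (L := L) (E := E)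
  constructor
  · rintro ⟨h, rfl⟩
    exact ⟨1 ⊗ₜ h, by ext x a; simp⟩
  · rintro ⟨z, hz⟩
    obtain ⟨h, rfl⟩ := (TensorProduct.isBaseChange K S.H E).exists_eq_of_fixed
      (fun g => ((g : E →ₐ[K] E).toLinearMap.rTensor S.H).toAddMonoidHom)
      (fun g e v => by
        induction v with
        | zero => simp
        | add a b ha hb => simp only [smul_add, map_add, ha, hb]
        | tmul a h => simp [TensorProduct.smul_tmul'])
      (fun g m => by simp) (v := z)
      (fun g => by
        apply S.act_injective
        ext1 x
        have h : x.toLinearMap =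
            (g : E →ₐ[K] E).toLinearMap ∘ₗ ((galPerm K L E g)⁻¹ x).toLinearMap := by
          rw [galPerm_inv_apply]
          ext a
          exact (g.apply_symm_apply (x a)).symm
        rw [hz, act_apply, h]
        refine (S.algHom_comp_precomp _ _ z).symm.trans ?_
        simp only [← act_apply, hz, ← LinearMap.comp_assoc, ← h])
    obtain ⟨x⟩ := this
    refine ⟨h, LinearMap.ext fun a => x.injective ?_⟩
    simpa using congrArg (fun f => f x a) hz

end Iso

lemma μ_injective : Function.Injective S.μ := by
  intro h k hhk
  have h1 : (1 : L) ⊗ₜ[K] h = 1 ⊗ₜ[K] k := S.bijective.1 (by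
    ext a; simpa [hopfGaloisMap] using congrArg (fun f => f a) hhk)
  exact Algebra.TensorProduct.includeRight_injective (algebraMap K L).injective h1

/-- The tensor square of a Hopf algebra acts faithfully on bilinear maps. -/
lemma eq_of_mul'_map_eq {s t : S.H ⊗[K] S.H}
    (h : ∀ x y, LinearMap.mul' K L
        (TensorProduct.map (S.μ.toLinearMap.flip x) (S.μ.toLinearMap.flip y) s) =
      LinearMap.mul' K L
        (TensorProduct.map (S.μ.toLinearMap.flip x) (S.μ.toLinearMap.flip y) t)) : s = t := by
  rw [← sub_eq_zero]
  set u := s - t with hu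
  -- Evaluating only the first factor at `x` lands in `L ⊗ H`, where injectivity of the Galois map
  -- detects zero.
  have hx : ∀ x, (S.μ.toLinearMap.flip x).rTensor S.H u = 0 := by
    intro x
    apply S.bijective.1
    rw [map_zero]
    ext y
    have h1 : ∀ z : S.H ⊗[K] S.H,
        hopfGaloisMap K L S.H S.μ ((S.μ.toLinearMap.flip x).rTensor S.H z) y =
        LinearMap.mul' K L
          (TensorProduct.map (S.μ.toLinearMap.flip x) (S.μ.toLinearMap.flip y) z) := by
      intro z
      induction z with
      | zero => simp
      | add a b ha hb => simp only [map_add, LinearMap.add_apply, ha, hb]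
      | tmul a b => simp [hopfGaloisMap]
    rw [h1, hu, map_sub, map_sub, h, sub_self]
    rfl
  classical
  -- Coordinates in the second factor reduce the rest to injectivity of `μ` on the first.
  let b := Module.finBasis K S.H
  apply (TensorProduct.equivFinsuppOfBasisRight b).injective
  ext i
  rw [map_zero, Finsupp.zero_apply]
  apply S.μ_injective
  rw [map_zero]
  ext x
  have h2 : ∀ z : S.H ⊗[K] S.H, S.μ (TensorProduct.equivFinsuppOfBasisRight b z i) x =
      TensorProduct.equivFinsuppOfBasisRight b ((S.μ.toLinearMap.flip x).rTensor S.H z) i := by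
    intro z
    induction z with
    | zero => simp
    | add a b ha hb =>
      simp only [map_add, Finsupp.add_apply, LinearMap.add_apply, ha, hb]
    | tmul a b => simp
  rw [h2, hx]
  simp

variable {S T} in
-- Equal images give an algebra isomorphism because `μ` is injective. It respects the coalgebra
-- structures, since the action determines the counit and, by `eq_of_mul'_map_eq`, the
-- comultiplication.
lemma iso_of_range_eq (h : S.μ.range = T.μ.range) : S.Iso T := by
  let e : S.H ≃ₐ[K] T.H := (AlgEquiv.ofInjective S.μ S.μ_injective).trans
    ((Subalgebra.equivOfEq _ _ h).trans (AlgEquiv.ofInjective T.μ T.μ_injective).symm)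
  have he : ∀ a, T.μ (e a) = S.μ a := by
    intro a
    exact congrArg Subtype.val ((AlgEquiv.ofInjective T.μ T.μ_injective).apply_symm_apply
      (Subalgebra.equivOfEq _ _ h (AlgEquiv.ofInjective S.μ S.μ_injective a)))
  have hmul : ∀ (z : S.H ⊗[K] S.H) x y, LinearMap.mul' K L
        (TensorProduct.map (T.μ.toLinearMap.flip x) (T.μ.toLinearMap.flip y)
          (Algebra.TensorProduct.map (e : S.H →ₐ[K] T.H) (e : S.H →ₐ[K] T.H) z)) =
      LinearMap.mul' K L
        (TensorProduct.map (S.μ.toLinearMap.flip x) (S.μ.toLinearMap.flip y) z) := by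
    intro z x y
    induction z with
    | zero => simp
    | add a b ha hb => simp only [map_add, ha, hb]
    | tmul a b => simp [he]
  refine ⟨BialgEquiv.ofAlgEquiv e ?_ ?_, he⟩
  · ext a
    apply (algebraMap K L).injective
    have := T.act_one (e a)
    rw [he, S.act_one] at this
    exact this.symm
  · ext a
    apply T.eq_of_mul'_map_eq
    intro x y
    have := T.act_mul (e a) x y
    rw [he, S.act_mul] at this
    exact (hmul _ x y).trans this

end HopfGaloisStructure

/-! ### Galois descent for vector spaces -/

section GaloisDescent

lemma IsBaseChange.of_basis_eq {K E M V I : Type*} [CommRing K] [CommRing E] [Algebra K E]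
    [AddCommGroup M] [Module K M] [AddCommGroup V] [Module K V] [Module E V] [IsScalarTower K E V]
    {f : M →ₗ[K] V} (b : Module.Basis I K M) (b' : Module.Basis I E V)
    (h : ∀ i, b' i = f (b i)) : IsBaseChange E f := by
  refine IsBaseChange.of_equiv ((b.baseChange E).equiv b' (Equiv.refl I)) fun x => ?_
  have : ((((b.baseChange E).equiv b' (Equiv.refl I)).toLinearMap.restrictScalars K) ∘ₗ
      TensorProduct.mk K E M 1) = f := by
    refine b.ext fun i => ?_
    have := (b.baseChange E).equiv_apply (i := i) b' (Equiv.refl I)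
    rw [Module.Basis.baseChange_apply] at this
    simpa [h] using this
  exact LinearMap.congr_fun this x

variable {K E V : Type*} [Field K] [Field E] [Algebra K E] [FiniteDimensional K E] [IsGalois K E]
  [AddCommGroup V] [Module K V] [Module E V] [IsScalarTower K E V]

/-- Galois descent for finite dimensional vector spaces. -/
lemma exists_basis_of_semilinear [Module.Finite E V] (ρ : Gal(E/K) → V →+ V)
    (hsmul : ∀ g (e : E) v, ρ g (e • v) = g e • ρ g v)
    (hmul : ∀ g h v, ρ (g * h) v = ρ g (ρ h v)) (hone : ∀ v, ρ 1 v = v)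
    (A : Submodule K V) (hA : ∀ v, v ∈ A ↔ ∀ g, ρ g v = v) : IsBaseChange E A.subtype := by
  have : Module.Finite K V := Module.Finite.trans E V
  let b := Module.finBasis K A
  have htrace : ∀ v, ∑ g, ρ g v ∈ A := by
    intro v
    refine (hA _).2 fun g => ?_
    rw [map_sum]
    simp only [← hmul]
    exact Fintype.sum_equiv (Equiv.mulLeft g) _ _ fun _ => rfl
  -- Scaling an `E`-relation by `e` and summing over the Galois group gives a `K`-relation with
  -- trace coefficients; nondegeneracy of the trace form finishes.
  have hli : LinearIndependent E fun i => (b i : V) := by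
    rw [Fintype.linearIndependent_iff]
    intro c hc i
    apply (traceForm_nondegenerate K E).1
    intro e
    have h1 : ∑ i, Algebra.trace K E (c i * e) • b i = 0 := by
      apply Subtype.ext
      rw [AddSubmonoidClass.coe_finsetSum, ZeroMemClass.coe_zero]
      calc ∑ i, ((Algebra.trace K E (c i * e) • b i : A) : V)
          = ∑ i, ∑ g, ρ g ((e * c i) • (b i : V)) := by
            refine Finset.sum_congr rfl fun i _ => ?_
            rw [Submodule.coe_smul, ← algebraMap_smul E, trace_eq_sum_automorphisms,
              Finset.sum_smul]
            refine Finset.sum_congr rfl fun g _ => ?_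
            rw [hsmul, (hA _).1 (b i).2, mul_comm]
        _ = ∑ g, ρ g (e • ∑ i, c i • (b i : V)) := by
            rw [Finset.sum_comm]
            simp only [Finset.smul_sum, map_sum, mul_smul]
        _ = 0 := by simp [hc]
    exact (Fintype.linearIndependent_iff.1 b.linearIndependent) _ h1 i
  have hspan : ⊤ ≤ Submodule.span E (Set.range fun i => (b i : V)) := by
    set W := Submodule.span E (Set.range fun i => (b i : V)) with hW
    have hAW : ∀ v ∈ A, v ∈ W := by
      intro v hv
      have : v = ∑ i, b.repr ⟨v, hv⟩ i • (b i : V) := by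
        have := congrArg A.subtype (b.sum_repr ⟨v, hv⟩)
        rw [map_sum] at this
        exact this.symm
      rw [this]
      refine Submodule.sum_mem _ fun i _ => ?_
      rw [← algebraMap_smul E]
      exact W.smul_mem _ (Submodule.subset_span ⟨i, rfl⟩)
    by_contra hne
    obtain ⟨f, hf0, hfW⟩ := Submodule.exists_le_ker_of_lt_top W
      (lt_top_iff_ne_top.2 (top_le_iff.not.1 hne))
    apply hf0
    ext v
    -- A functional `f` vanishing on all sums `∑ g, ρ g (e • v)` yields a linear relation between
    -- automorphisms; the coefficient at `g = 1` is `f v`.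
    have hchar : LinearIndependent E (fun g : Gal(E/K) => (g : E →ₐ[K] E).toLinearMap) :=
      (linearIndependent_toLinearMap K E E).comp (fun g : Gal(E/K) => (g : E →ₐ[K] E))
        AlgEquiv.coe_toAlgHom_injective
    have h0 : ∑ g : Gal(E/K), f (ρ g v) • (g : E →ₐ[K] E).toLinearMap = 0 := by
      ext e
      have h2 : f (∑ g, ρ g (e • v)) = 0 := hfW (hAW _ (htrace _))
      simpa [hsmul, mul_comm] using h2
    have := Fintype.linearIndependent_iff.1 hchar _ h0 1
    rwa [hone] at this
  exact IsBaseChange.of_basis_eq b (Module.Basis.mk hli hspan) fun i => by simp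

end GaloisDescent

/-! ### Forms of group algebras and their Hopf structure -/

section FormsOfGroupAlgebras

open MonoidAlgebra

variable {K E : Type*} [Field K] [Field E] [Algebra K E]

/-- The semilinear automorphism of the group algebra induced by an automorphism of the
coefficients and an endomorphism of the group. -/
noncomputable def semilinearMap {N : Type*} [CommMonoid N] (g : Gal(E/K)) (θ : N →* N) :
    MonoidAlgebra E N →ₐ[K] MonoidAlgebra E N :=
  (mapDomainAlgHom K E θ).comp (mapAlgHom N (g : E →ₐ[K] E))

@[simp] lemma semilinearMap_single {N : Type*} [CommMonoid N] (g : Gal(E/K)) (θ : N →* N)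
    (n : N) (e : E) : semilinearMap g θ (single n e) = single (θ n) (g e) := by
  simp [semilinearMap]

lemma semilinearMap_smul {N : Type*} [CommMonoid N] (g : Gal(E/K)) (θ : N →* N) (e : E)
    (c : MonoidAlgebra E N) :
    semilinearMap g θ (e • c) = g e • semilinearMap g θ c := by
  induction c using MonoidAlgebra.induction_linear with
  | zero => simp
  | add a b ha hb => simp only [smul_add, map_add, ha, hb]
  | single n e => simp

lemma semilinearMap_mapDomain {M N : Type*} [CommMonoid M] [CommMonoid N] (g : Gal(E/K))
    (θ : M →* M) (η : N →* N) (f : M →* N) (hf : ∀ m, η (f m) = f (θ m)) (c : MonoidAlgebra E M) :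
    semilinearMap g η (mapDomainAlgHom K E f c) = mapDomainAlgHom K E f (semilinearMap g θ c) := by
  induction c using MonoidAlgebra.induction_linear with
  | zero => simp
  | add a b ha hb => simp only [map_add, ha, hb]
  | single n e => simp [hf]

variable {A B : Type*} [CommRing A] [Algebra K A] [CommRing B] [Algebra K B]
  {M N : Type*} [CommGroup M] [CommGroup N]

/-- The product of two maps into group algebras, with values in the group algebra of the
product. -/
noncomputable def boxProd (ι : A →ₐ[K] MonoidAlgebra E M) (κ : B →ₐ[K] MonoidAlgebra E N) :
    A ⊗[K] B →ₐ[K] MonoidAlgebra E (M × N) :=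
  Algebra.TensorProduct.lift ((mapDomainAlgHom K E (MonoidHom.inl M N)).comp ι)
    ((mapDomainAlgHom K E (MonoidHom.inr M N)).comp κ) fun _ _ => Commute.all _ _

lemma boxProd_tmul (ι : A →ₐ[K] MonoidAlgebra E M) (κ : B →ₐ[K] MonoidAlgebra E N) (a : A) (b : B) :
    boxProd ι κ (a ⊗ₜ b) = mapDomainAlgHom K E (MonoidHom.inl M N) (ι a) *
      mapDomainAlgHom K E (MonoidHom.inr M N) (κ b) := by
  simp [boxProd]

lemma tensorEquiv_tmul (c : MonoidAlgebra E M) (d : MonoidAlgebra E N) :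
    tensorEquiv E (c ⊗ₜ d) = mapDomainAlgHom K E (MonoidHom.inl M N) c *
      mapDomainAlgHom K E (MonoidHom.inr M N) d := by
  induction c using MonoidAlgebra.induction_linear with
  | zero => simp
  | add a b ha hb => simp only [map_add, TensorProduct.add_tmul, add_mul, ha, hb]
  | single n e =>
    induction d using MonoidAlgebra.induction_linear with
    | zero => simp
    | add a b ha hb => simp only [map_add, TensorProduct.tmul_add, mul_add, ha, hb]
    | single n e => simp [single_mul_single]

lemma isBaseChange_boxProd [Module.Finite K A] [Module.Finite K B]
    {ι : A →ₐ[K] MonoidAlgebra E M} {κ : B →ₐ[K] MonoidAlgebra E N}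
    (hι : IsBaseChange E ι.toLinearMap) (hκ : IsBaseChange E κ.toLinearMap) :
    IsBaseChange E (boxProd ι κ).toLinearMap := by
  let b := Module.finBasis K A
  let c := Module.finBasis K B
  refine IsBaseChange.of_basis_eq (b.tensorProduct c)
    ((((b.baseChange E).map hι.equiv).tensorProduct ((c.baseChange E).map hκ.equiv)).map
      (tensorEquiv E)) fun ⟨i, j⟩ => ?_
  simp [Module.Basis.tensorProduct_apply, hι.equiv_tmul, hκ.equiv_tmul, boxProd_tmul,
    tensorEquiv_tmul (K := K)]

lemma IsBaseChange.injective_of_field {V : Type*} [AddCommGroup V] [Module K V] [Module E V]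
    [IsScalarTower K E V] {f : A →ₗ[K] V} (hf : IsBaseChange E f) : Function.Injective f := by
  intro a b h
  rw [← one_smul E (f a), ← one_smul E (f b), ← hf.equiv_tmul, ← hf.equiv_tmul] at h
  exact Algebra.TensorProduct.includeRight_injective (A := E) (algebraMap K E).injective
    (hf.equiv.injective h)

lemma AlgHom.exists_comp_eq_of_range_le {C : Type*} [CommRing C] [Algebra K C]
    (j : B →ₐ[K] C) (hj : Function.Injective j) (f : A →ₐ[K] C) (h : ∀ a, ∃ b, j b = f a) :
    ∃ k : A →ₐ[K] B, ∀ a, j (k a) = f a := by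
  let f' : A →ₐ[K] j.range := f.codRestrict j.range h
  refine ⟨(AlgEquiv.ofInjective j hj).symm.toAlgHom.comp f', fun a => ?_⟩
  exact congrArg Subtype.val ((AlgEquiv.ofInjective j hj).apply_symm_apply (f' a))

end FormsOfGroupAlgebras

section FormsOfGroupAlgebras

open MonoidAlgebra

variable {K E : Type*} [Field K] [Field E] [Algebra K E]
  {A B : Type*} [CommRing A] [Algebra K A] [CommRing B] [Algebra K B]
  {M N : Type*} [CommGroup M] [CommGroup N]

/-- The map `ι` exhibits `A` as the `K`-algebra of invariants of `E[N]` under the semilinear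
action of the Galois group given by its action `θ` on `N`. -/
structure IsGroupAlgebraForm (θ : Gal(E/K) → N →* N) (ι : A →ₐ[K] MonoidAlgebra E N) : Prop where
  isBaseChange : IsBaseChange E ι.toLinearMap
  fixed : ∀ g a, semilinearMap g (θ g) (ι a) = ι a

namespace IsGroupAlgebraForm

variable {θ : Gal(E/K) → N →* N} {η : Gal(E/K) → M →* M} {ι : A →ₐ[K] MonoidAlgebra E N}
  {κ : B →ₐ[K] MonoidAlgebra E M}

lemma injective (hι : IsGroupAlgebraForm θ ι) : Function.Injective ι :=
  hι.isBaseChange.injective_of_field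

lemma boxProd [Module.Finite K A] [Module.Finite K B] (hι : IsGroupAlgebraForm θ ι)
    (hκ : IsGroupAlgebraForm η κ) :
    IsGroupAlgebraForm (fun g => (θ g).prodMap (η g)) (boxProd ι κ) where
  isBaseChange := isBaseChange_boxProd hι.isBaseChange hκ.isBaseChange
  fixed g t := by
    induction t with
    | zero => simp
    | add a b ha hb => simp only [map_add, ha, hb]
    | tmul a b =>
      rw [boxProd_tmul, map_mul, semilinearMap_mapDomain g (θ g) _ _ (by simp),
        semilinearMap_mapDomain g (η g) _ _ (by simp), hι.fixed, hκ.fixed]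

lemma mapDomainAlgHom_one (c : MonoidAlgebra E N) :
    mapDomainAlgHom K E (1 : N →* M) c = algebraMap E _ (Coalgebra.counit (R := E) c) := by
  induction c using MonoidAlgebra.induction_linear with
  | zero => simp
  | add a b ha hb => simp only [map_add, ha, hb]
  | single n e => simp

lemma mapDomainAlgHom_mapDomainAlgHom {P : Type*} [CommGroup P] (f : N →* M) (g : M →* P)
    (c : MonoidAlgebra E N) : mapDomainAlgHom K E g (mapDomainAlgHom K E f c) =
      mapDomainAlgHom K E (g.comp f) c := by
  rw [mapDomainAlgHom_comp]; rfl

lemma mapDomainAlgHom_boxProd {P : Type*} [CommGroup P] (f : N × M →* P) (a : A) (b : B) :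
    mapDomainAlgHom K E f (_root_.boxProd ι κ (a ⊗ₜ b)) =
      mapDomainAlgHom K E (f.comp (.inl N M)) (ι a) *
        mapDomainAlgHom K E (f.comp (.inr N M)) (κ b) := by
  rw [boxProd_tmul, map_mul, mapDomainAlgHom_mapDomainAlgHom, mapDomainAlgHom_mapDomainAlgHom]

variable [FiniteDimensional K E] [IsGalois K E]

/-- An equivariant group homomorphism carries invariants to invariants. The comultiplication and
antipode are obtained this way from the diagonal and from inversion. -/
lemma exists_lift [Module.Finite K B] (hι : IsGroupAlgebraForm θ ι) (hκ : IsGroupAlgebraForm η κ)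
    (f : N →* M) (hf : ∀ g n, η g (f n) = f (θ g n)) :
    ∃ k : A →ₐ[K] B, ∀ a, κ (k a) = mapDomainAlgHom K E f (ι a) := by
  refine AlgHom.exists_comp_eq_of_range_le κ hκ.injective
    ((mapDomainAlgHom K E f).comp ι) fun a => ?_
  refine hκ.isBaseChange.exists_eq_of_fixed
    (fun g => (semilinearMap g (η g)).toLinearMap.toAddMonoidHom)
    (fun g e v => semilinearMap_smul g (η g) e v) (fun g m => hκ.fixed g m) fun g => ?_
  change semilinearMap g (η g) (mapDomainAlgHom K E f (ι a)) = mapDomainAlgHom K E f (ι a)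
  rw [semilinearMap_mapDomain g (θ g) _ _ (hf g), hι.fixed]

lemma exists_counit (hι : IsGroupAlgebraForm θ ι) :
    ∃ k : A →ₐ[K] K, ∀ a, algebraMap K E (k a) = Coalgebra.counit (R := E) (ι a) := by
  refine AlgHom.exists_comp_eq_of_range_le (Algebra.ofId K E) (algebraMap K E).injective
    (((Bialgebra.counitAlgHom E (MonoidAlgebra E N)).restrictScalars K).comp ι) fun a => ?_
  refine (IsGalois.mem_range_algebraMap_iff_fixed (F := K) (E := E) _).2 fun g => ?_
  change g (Coalgebra.counit (R := E) (ι a)) = Coalgebra.counit (R := E) (ι a)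
  conv_rhs => rw [← hι.fixed g]
  generalize ι a = c
  induction c using MonoidAlgebra.induction_linear with
  | zero => simp
  | add a b ha hb => simp only [map_add, ha, hb]
  | single n e => simp

section Hopf

variable [Module.Finite K A] (hι : IsGroupAlgebraForm θ ι)

/-- The diagonal homomorphism. -/
def _root_.MonoidHom.diag (N : Type*) [CommGroup N] : N →* N × N := (MonoidHom.id N).prod (.id N)

/-- The comultiplication of a form of a group algebra. -/
noncomputable def comul : A →ₐ[K] A ⊗[K] A :=
  (hι.exists_lift (hι.boxProd hι) (MonoidHom.diag N) fun _ _ => rfl).choose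

lemma boxProd_comul (a : A) : _root_.boxProd ι ι (hι.comul a) =
    mapDomainAlgHom K E (MonoidHom.diag N) (ι a) :=
  (hι.exists_lift (hι.boxProd hι) (MonoidHom.diag N) fun _ _ => rfl).choose_spec a

/-- The antipode of a form of a group algebra. -/
noncomputable def antipode : A →ₐ[K] A :=
  (hι.exists_lift hι invMonoidHom fun _ _ => by simp).choose

lemma ι_antipode (a : A) : ι (hι.antipode a) = mapDomainAlgHom K E invMonoidHom (ι a) :=
  (hι.exists_lift hι invMonoidHom fun _ _ => by simp).choose_spec a

/-- The counit of a form of a group algebra. -/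
noncomputable def counit : A →ₐ[K] K := hι.exists_counit.choose

omit [Module.Finite K A] in
lemma algebraMap_counit (a : A) : algebraMap K E (hι.counit a) = Coalgebra.counit (R := E) (ι a) :=
  hι.exists_counit.choose_spec a

/-- The iterated product of a map into a group algebra with itself. -/
noncomputable def boxProd₃ (ι : A →ₐ[K] MonoidAlgebra E N) :
    A ⊗[K] (A ⊗[K] A) →ₐ[K] MonoidAlgebra E (N × (N × N)) :=
  _root_.boxProd ι (_root_.boxProd ι ι)

omit [FiniteDimensional K E] [IsGalois K E] [Module.Finite K A] in
lemma boxProd₃_tmul (a : A) (t : A ⊗[K] A) : boxProd₃ ι (a ⊗ₜ t) =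
    mapDomainAlgHom K E (MonoidHom.inl N (N × N)) (ι a) *
      mapDomainAlgHom K E (MonoidHom.inr N (N × N)) (_root_.boxProd ι ι t) := by
  rw [boxProd₃, boxProd_tmul]

omit [FiniteDimensional K E] [IsGalois K E] in
include hι in
-- The threefold tensor power is again a form, now of `E[N × N × N]`, so coassociativity may be
-- tested there.
lemma boxProd₃_injective : Function.Injective (boxProd₃ ι) :=
  (hι.boxProd (hι.boxProd hι) : IsGroupAlgebraForm _ (boxProd₃ ι)).injective

omit [FiniteDimensional K E] [IsGalois K E] [Module.Finite K A] in
lemma boxProd_assoc_tmul (t : A ⊗[K] A) (b : A) : boxProd₃ ι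
    (Algebra.TensorProduct.assoc K K K A A A (t ⊗ₜ b)) =
      mapDomainAlgHom K E ((MonoidHom.id N).prodMap (.inl N N)) (_root_.boxProd ι ι t) *
        mapDomainAlgHom K E ((MonoidHom.inr N (N × N)).comp (.inr N N)) (ι b) := by
  induction t with
  | zero => simp
  | add a c ha hc => simp only [map_add, TensorProduct.add_tmul, add_mul, ha, hc]
  | tmul a c =>
    rw [Algebra.TensorProduct.assoc_tmul, boxProd₃_tmul, boxProd_tmul, map_mul,
      mapDomainAlgHom_boxProd, ← mul_assoc, mapDomainAlgHom_mapDomainAlgHom,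
      mapDomainAlgHom_mapDomainAlgHom]
    rfl

lemma boxProd_assoc_map_comul (t : A ⊗[K] A) : boxProd₃ ι
    (Algebra.TensorProduct.assoc K K K A A A
      (Algebra.TensorProduct.map hι.comul (.id K A) t)) =
      mapDomainAlgHom K E ((MonoidHom.fst N N).prod (.id _)) (_root_.boxProd ι ι t) := by
  induction t with
  | zero => simp
  | add a c ha hc => simp only [map_add, ha, hc]
  | tmul a c =>
    rw [Algebra.TensorProduct.map_tmul, boxProd_assoc_tmul, boxProd_comul,
      mapDomainAlgHom_boxProd, mapDomainAlgHom_mapDomainAlgHom]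
    rfl

lemma boxProd_map_comul (t : A ⊗[K] A) : boxProd₃ ι
    (Algebra.TensorProduct.map (.id K A) hι.comul t) =
      mapDomainAlgHom K E ((MonoidHom.id N).prodMap (.diag N)) (_root_.boxProd ι ι t) := by
  induction t with
  | zero => simp
  | add a c ha hc => simp only [map_add, ha, hc]
  | tmul a c =>
    rw [Algebra.TensorProduct.map_tmul, boxProd₃_tmul, AlgHom.id_apply, boxProd_comul,
      mapDomainAlgHom_boxProd, mapDomainAlgHom_mapDomainAlgHom]
    rfl

/-- Inside `E[N × N × N]` both sides are induced by the same homomorphism `n ↦ (n, n, n)`. -/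
lemma coassoc : (Algebra.TensorProduct.assoc K K K A A A).toAlgHom.comp
      ((Algebra.TensorProduct.map hι.comul (.id K A)).comp hι.comul)
      = (Algebra.TensorProduct.map (.id K A) hι.comul).comp hι.comul := by
  refine AlgHom.ext fun a => hι.boxProd₃_injective ?_
  refine (hι.boxProd_assoc_map_comul (hι.comul a)).trans
    (Eq.trans ?_ (hι.boxProd_map_comul (hι.comul a)).symm)
  rw [boxProd_comul, mapDomainAlgHom_mapDomainAlgHom, mapDomainAlgHom_mapDomainAlgHom]
  rfl

lemma counit_rTensor : (Algebra.TensorProduct.map hι.counit (.id K A)).comp hι.comul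
      = (Algebra.TensorProduct.lid K A).symm := by
  have h : ∀ t : A ⊗[K] A, ι (Algebra.TensorProduct.lid K A
      (Algebra.TensorProduct.map hι.counit (.id K A) t)) =
      mapDomainAlgHom K E (MonoidHom.snd N N) (_root_.boxProd ι ι t) := by
    intro t
    induction t with
    | zero => simp
    | add a c ha hc => simp only [map_add, ha, hc]
    | tmul a c =>
      rw [mapDomainAlgHom_boxProd, MonoidHom.snd_comp_inl, mapDomainAlgHom_one,
        ← hι.algebraMap_counit, MonoidHom.snd_comp_inr, mapDomainAlgHom_id,
        ← IsScalarTower.algebraMap_apply, ← Algebra.smul_def]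
      simp
  refine AlgHom.ext fun a => ?_
  apply (Algebra.TensorProduct.lid K A).injective
  apply hι.injective
  refine (h (hι.comul a)).trans ?_
  rw [boxProd_comul, mapDomainAlgHom_mapDomainAlgHom]
  refine (AlgHom.congr_fun (mapDomainAlgHom_id (R := K) (A := E) (M := N)) (ι a)).trans ?_
  simp

lemma counit_lTensor : (Algebra.TensorProduct.map (.id K A) hι.counit).comp hι.comul
      = (Algebra.TensorProduct.rid K K A).symm := by
  have h : ∀ t : A ⊗[K] A, ι (Algebra.TensorProduct.rid K K A
      (Algebra.TensorProduct.map (.id K A) hι.counit t)) =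
      mapDomainAlgHom K E (MonoidHom.fst N N) (_root_.boxProd ι ι t) := by
    intro t
    induction t with
    | zero => simp
    | add a c ha hc => simp only [map_add, ha, hc]
    | tmul a c =>
      rw [mapDomainAlgHom_boxProd, MonoidHom.fst_comp_inr, mapDomainAlgHom_one,
        ← hι.algebraMap_counit, MonoidHom.fst_comp_inl, mapDomainAlgHom_id,
        ← IsScalarTower.algebraMap_apply, mul_comm, ← Algebra.smul_def]
      simp
  refine AlgHom.ext fun a => ?_
  apply (Algebra.TensorProduct.rid K K A).injective
  apply hι.injective
  refine (h (hι.comul a)).trans ?_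
  rw [boxProd_comul, mapDomainAlgHom_mapDomainAlgHom]
  refine (AlgHom.congr_fun (mapDomainAlgHom_id (R := K) (A := E) (M := N)) (ι a)).trans ?_
  simp

/-- The bialgebra structure on a form of a group algebra. -/
@[reducible] noncomputable def bialgebra : Bialgebra K A :=
  Bialgebra.ofAlgHom hι.comul hι.counit hι.coassoc hι.counit_rTensor hι.counit_lTensor

lemma isCocomm : letI := hι.bialgebra; Coalgebra.IsCocomm K A := by
  let := hι.bialgebra
  have h : ∀ t : A ⊗[K] A, _root_.boxProd ι ι (TensorProduct.comm K A A t) =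
      mapDomainAlgHom K E ((MonoidHom.snd N N).prod (.fst N N)) (_root_.boxProd ι ι t) := by
    intro t
    induction t with
    | zero => simp
    | add a c ha hc => simp only [map_add, ha, hc]
    | tmul a c =>
      rw [mapDomainAlgHom_boxProd, TensorProduct.comm_tmul, boxProd_tmul, mul_comm]
      rfl
  refine ⟨LinearMap.ext fun a => (hι.boxProd hι).injective ?_⟩
  refine (h (hι.comul a)).trans ?_
  change _ = _root_.boxProd ι ι (hι.comul a)
  rw [boxProd_comul, mapDomainAlgHom_mapDomainAlgHom]
  rfl

lemma lift_antipode_comul (a : A) :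
    Algebra.TensorProduct.lift hι.antipode (.id K A) (fun _ => Commute.all _) (hι.comul a) =
      algebraMap K A (hι.counit a) := by
  have h : ∀ t : A ⊗[K] A, ι (Algebra.TensorProduct.lift hι.antipode (.id K A)
      (fun _ => Commute.all _) t) =
      mapDomainAlgHom K E (MonoidHom.coprod invMonoidHom (.id N)) (_root_.boxProd ι ι t) := by
    intro t
    induction t with
    | zero => simp
    | add a c ha hc => simp only [map_add, ha, hc]
    | tmul a c =>
      rw [mapDomainAlgHom_boxProd, MonoidHom.coprod_comp_inl, MonoidHom.coprod_comp_inr,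
        mapDomainAlgHom_id, ← ι_antipode]
      exact map_mul ι _ _
  apply hι.injective
  rw [h, boxProd_comul, mapDomainAlgHom_mapDomainAlgHom, AlgHom.commutes,
    IsScalarTower.algebraMap_apply K E, algebraMap_counit, ← mapDomainAlgHom_one (K := K)]
  congr 2
  ext n
  simp [MonoidHom.diag]

lemma lift_id_antipode_comul (a : A) :
    Algebra.TensorProduct.lift (.id K A) hι.antipode (fun _ _ => Commute.all _ _) (hι.comul a) =
      algebraMap K A (hι.counit a) := by
  have h : ∀ t : A ⊗[K] A, ι (Algebra.TensorProduct.lift (.id K A) hι.antipode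
      (fun _ _ => Commute.all _ _) t) =
      mapDomainAlgHom K E (MonoidHom.coprod (.id N) invMonoidHom) (_root_.boxProd ι ι t) := by
    intro t
    induction t with
    | zero => simp
    | add a c ha hc => simp only [map_add, ha, hc]
    | tmul a c =>
      rw [mapDomainAlgHom_boxProd, MonoidHom.coprod_comp_inl, MonoidHom.coprod_comp_inr,
        mapDomainAlgHom_id, ← ι_antipode]
      exact map_mul ι _ _
  apply hι.injective
  rw [h, boxProd_comul, mapDomainAlgHom_mapDomainAlgHom, AlgHom.commutes,
    IsScalarTower.algebraMap_apply K E, algebraMap_counit, ← mapDomainAlgHom_one (K := K)]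
  congr 2
  ext n
  simp [MonoidHom.diag]

/-- The Hopf algebra structure on a form of a group algebra. -/
@[reducible] noncomputable def hopfAlgebra : HopfAlgebra K A :=
  letI := hι.bialgebra
  HopfAlgebra.ofAlgHom hι.antipode (AlgHom.ext hι.lift_antipode_comul)
    (AlgHom.ext hι.lift_id_antipode_comul)

end Hopf

end IsGroupAlgebraForm

end FormsOfGroupAlgebras

/-! ### The action of a form on `L` -/

section FormAction

open MonoidAlgebra

variable {K : Type u} {L : Type v} {E : Type w} [Field K] [Field L] [Field E]
  [Algebra K L] [Algebra K E] {N : Type*} [CommGroup N] (ρ : N →* Equiv.Perm (L →ₐ[K] E))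

/-- The action of a group algebra on the embeddings of `L`. -/
noncomputable def evalAt (x : L →ₐ[K] E) : MonoidAlgebra E N →ₗ[E] (L →ₗ[K] E) :=
  (Finsupp.linearCombination E fun n => (ρ n x).toLinearMap) ∘ₗ
    (coeffLinearEquiv E : MonoidAlgebra E N ≃ₗ[E] (N →₀ E)).toLinearMap

@[simp] lemma evalAt_single (x : L →ₐ[K] E) (n : N) (e : E) :
    evalAt ρ x (single n e) = e • (ρ n x).toLinearMap := by
  simp [evalAt]

lemma evalAt_one (x : L →ₐ[K] E) : evalAt ρ x 1 = x.toLinearMap := by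
  simp [one_def]

lemma evalAt_apply_one (x : L →ₐ[K] E) (c : MonoidAlgebra E N) :
    evalAt ρ x c 1 = Coalgebra.counit (R := E) c := by
  induction c using MonoidAlgebra.induction_linear with
  | zero => simp
  | add a b ha hb => simp only [map_add, LinearMap.add_apply, ha, hb]
  | single n e => simp

lemma comp_evalAt {θ : Gal(E/K) → N →* N}
    (hρ : ∀ g n x, galPerm K L E g (ρ n x) = ρ (θ g n) (galPerm K L E g x))
    (g : Gal(E/K)) (x : L →ₐ[K] E) (c : MonoidAlgebra E N) (a : L) :
    g (evalAt ρ x c a) = evalAt ρ (galPerm K L E g x) (semilinearMap g (θ g) c) a := by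
  induction c using MonoidAlgebra.induction_linear with
  | zero => simp
  | add a b ha hb => simp only [map_add, LinearMap.add_apply, ha, hb]
  | single n e =>
    have := AlgHom.congr_fun (hρ g n x) a
    simp only [evalAt_single, LinearMap.smul_apply, smul_eq_mul, map_mul, semilinearMap_single,
      AlgHom.toLinearMap_apply, ← this]
    rfl

/-- The action of the tensor square of a group algebra on pairs of elements of `L`. -/
noncomputable def evalAt₂ (x : L →ₐ[K] E) (a b : L) : MonoidAlgebra E (N × N) →ₗ[E] E :=
  (Finsupp.linearCombination E fun n => ρ n.1 x a * ρ n.2 x b) ∘ₗ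
    (coeffLinearEquiv E : MonoidAlgebra E (N × N) ≃ₗ[E] (N × N →₀ E)).toLinearMap

@[simp] lemma evalAt₂_single (x : L →ₐ[K] E) (a b : L) (n : N × N) (e : E) :
    evalAt₂ ρ x a b (single n e) = e * (ρ n.1 x a * ρ n.2 x b) := by
  simp [evalAt₂]

lemma evalAt_apply_mul (x : L →ₐ[K] E) (c : MonoidAlgebra E N) (a b : L) :
    evalAt ρ x c (a * b) = evalAt₂ ρ x a b (mapDomainAlgHom K E (MonoidHom.diag N) c) := by
  induction c using MonoidAlgebra.induction_linear with
  | zero => simp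
  | add a b ha hb => simp only [map_add, LinearMap.add_apply, ha, hb]
  | single n e => simp [MonoidHom.diag]

lemma evalAt₂_mul (x : L →ₐ[K] E) (a b : L) (c d : MonoidAlgebra E N) :
    evalAt₂ ρ x a b (mapDomainAlgHom K E (MonoidHom.inl N N) c *
      mapDomainAlgHom K E (MonoidHom.inr N N) d) = evalAt ρ x c a * evalAt ρ x d b := by
  induction c using MonoidAlgebra.induction_linear with
  | zero => simp
  | add a b ha hb => simp only [map_add, LinearMap.add_apply, add_mul, ha, hb]
  | single n e =>
    induction d using MonoidAlgebra.induction_linear with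
    | zero => simp
    | add a b ha hb => simp only [map_add, LinearMap.add_apply, mul_add, ha, hb]
    | single m f => simp [single_mul_single]; ring

variable [FiniteDimensional K L] [Algebra.IsSeparable K L] [IsNormalClosure K L E]
  {A : Type u} [CommRing A] [Algebra K A]
  {θ : Gal(E/K) → N →* N} {ι : A →ₐ[K] MonoidAlgebra E N}

/-- Invariance of `ι h` makes `x ↦ evalAt ρ x (ι h) a` equivariant, so it is evaluation at a unique
element of `L`, which serves as `μ h a`. -/
lemma exists_formAction (hι : IsGroupAlgebraForm θ ι)
    (hρ : ∀ g n x, galPerm K L E g (ρ n x) = ρ (θ g n) (galPerm K L E g x)) :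
    ∃ μ : A →ₐ[K] Module.End K L, ∀ h x a, x (μ h a) = evalAt ρ x (ι h) a := by
  obtain ⟨x₀⟩ := nonempty_algHom_of_isNormalClosure (K := K) (L := L) (E := E)
  have hex : ∀ (h : A) (a : L), ∃ b : L, ∀ x : L →ₐ[K] E, evalAt ρ x (ι h) a = x b := by
    intro h a
    refine exists_apply_eq_of_equivariant (fun x => evalAt ρ x (ι h) a) fun g x => ?_
    rw [comp_evalAt ρ hρ, hι.fixed]
  choose m hm using hex
  have heq : ∀ {a b : L}, (∀ x : L →ₐ[K] E, x a = x b) → a = b := fun h => x₀.injective (h x₀)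
  let μ₀ : A →ₗ[K] Module.End K L := LinearMap.mk₂ K m
    (fun h k a => heq fun x => by simp only [map_add, ← hm, LinearMap.add_apply])
    (fun r h a => heq fun x => by
      simp only [map_smul, ← hm]
      rw [← algebraMap_smul E r (ι h), map_smul, LinearMap.smul_apply, algebraMap_smul])
    (fun h a b => heq fun x => by simp only [map_add, ← hm])
    (fun r h a => heq fun x => by simp only [map_smul, ← hm])
  have hmul : ∀ (x : L →ₐ[K] E) (c : MonoidAlgebra E N) (k : A) (a : L),
      evalAt ρ x (c * ι k) a = evalAt ρ x c (m k a) := by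
    intro x c k a
    induction c using MonoidAlgebra.induction_linear with
    | zero => simp
    | add c d hc hd => simp only [add_mul, map_add, LinearMap.add_apply, hc, hd]
    | single n e =>
      rw [evalAt_single, LinearMap.smul_apply, AlgHom.toLinearMap_apply, ← hm]
      generalize ι k = d
      induction d using MonoidAlgebra.induction_linear with
      | zero => simp
      | add c d hc hd =>
        simp only [mul_add, map_add, LinearMap.add_apply, hc, hd, smul_add]
      | single l f =>
        simp [single_mul_single, mul_comm n l, map_mul ρ, mul_assoc]
  refine ⟨AlgHom.ofLinearMap μ₀ ?_ ?_, fun h x a => (hm h a x).symm⟩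
  · refine LinearMap.ext fun a => heq fun x => ?_
    change x (m 1 a) = x a
    rw [← hm, map_one, evalAt_one]
    rfl
  · intro h k
    refine LinearMap.ext fun a => heq fun x => ?_
    change x (m (h * k) a) = x (m h (m k a))
    rw [← hm, ← hm, map_mul, hmul]

omit [FiniteDimensional K L] [Algebra.IsSeparable K L] [IsNormalClosure K L E] in
-- Dedekind's independence of embeddings: regularity makes the `ρ n x` distinct.
lemma evalAt_injective (hreg : ∀ x, Function.Bijective fun n => ρ n x) (x : L →ₐ[K] E) :
    Function.Injective (evalAt ρ x) := by
  have h : LinearIndependent E fun n : N => (ρ n x).toLinearMap :=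
    (linearIndependent_toLinearMap K L E).comp _ (hreg x).1
  rw [evalAt, LinearMap.coe_comp]
  exact Function.Injective.comp h (LinearEquiv.injective _)

lemma finrank_form [Module.Finite K A] (hι : IsGroupAlgebraForm θ ι)
    (hreg : ∀ x, Function.Bijective fun n => ρ n x) : Module.finrank K A = Module.finrank K L := by
  obtain ⟨x⟩ := nonempty_algHom_of_isNormalClosure (K := K) (L := L) (E := E)
  have : Finite N := Finite.of_injective _ (hreg x).1
  have := Fintype.ofFinite N
  rw [← card_algHom_of_isNormalClosure (E := E), ← Nat.card_congr (Equiv.ofBijective _ (hreg x)),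
    ← Module.finrank_baseChange (R := E), hι.isBaseChange.equiv.finrank_eq,
    (MonoidAlgebra.coeffLinearEquiv E).finrank_eq, Module.finrank_finsupp_self,
    Nat.card_eq_fintype_card]

lemma bijective_hopfGaloisMap_of_form [Module.Finite K A] (hι : IsGroupAlgebraForm θ ι)
    (hreg : ∀ x, Function.Bijective fun n => ρ n x) {μ : A →ₐ[K] Module.End K L}
    (hμ : ∀ h (x : L →ₐ[K] E) a, x (μ h a) = evalAt ρ x (ι h) a) :
    Function.Bijective (hopfGaloisMap K L A μ) := by
  obtain ⟨x⟩ := nonempty_algHom_of_isNormalClosure (K := K) (L := L) (E := E)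
  have hcomp : ∀ t, x.toLinearMap ∘ₗ hopfGaloisMap K L A μ t =
      evalAt ρ x (hι.isBaseChange.equiv (x.toLinearMap.rTensor A t)) := by
    intro t
    induction t with
    | zero => simp
    | add s t hs ht => simp only [map_add, LinearMap.comp_add, hs, ht]
    | tmul l h =>
      ext a
      rw [LinearMap.rTensor_tmul, hι.isBaseChange.equiv_tmul]
      simp [hopfGaloisMap, hμ]
  have hinj : Function.Injective (hopfGaloisMap K L A μ) := by
    intro s t hst
    have h := congrArg (fun φ => x.toLinearMap ∘ₗ φ) hst
    simp only [hcomp] at h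
    exact Module.Flat.rTensor_preserves_injective_linearMap _ x.injective
      (hι.isBaseChange.equiv.injective (evalAt_injective ρ hreg x h))
  refine ⟨hinj, (LinearMap.injective_iff_surjective_of_finrank_eq_finrank ?_).1 hinj⟩
  rw [Module.finrank_tensorProduct, Module.finrank_linearMap, finrank_form ρ hι hreg]

omit [FiniteDimensional K L] [Algebra.IsSeparable K L] [IsNormalClosure K L E] in
lemma tensorEquiv_comul (c : MonoidAlgebra E N) :
    tensorEquiv E (Coalgebra.comul (R := E) c) = mapDomainAlgHom K E (MonoidHom.diag N) c := by
  induction c using MonoidAlgebra.induction_linear with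
  | zero => simp
  | add a b ha hb => simp only [map_add, ha, hb]
  | single n e => simp [MonoidHom.diag]

/-- A form of the group algebra of a regular group of permutations which is normalised by the
Galois group defines a Hopf Galois structure. -/
lemma exists_hopfGaloisStructure_of_form [Module.Finite K A] (hι : IsGroupAlgebraForm θ ι)
    (hρ : ∀ g n x, galPerm K L E g (ρ n x) = ρ (θ g n) (galPerm K L E g x))
    (hreg : ∀ x, Function.Bijective fun n => ρ n x) :
    ∃ (S : HopfGaloisStructure K L) (Φ : (E ⊗[K] S.H) ≃ₐc[E] MonoidAlgebra E N),
      S.permHom Φ = ρ := by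
  have := isGalois_of_isNormalClosure (K := K) (L := L) (E := E)
  have := finiteDimensional_of_isNormalClosure (K := K) (L := L) (E := E)
  obtain ⟨x₀⟩ := nonempty_algHom_of_isNormalClosure (K := K) (L := L) (E := E)
  obtain ⟨μ, hμ⟩ := exists_formAction ρ hι hρ
  let := hι.hopfAlgebra
  have := hι.isCocomm
  let S : HopfGaloisStructure K L :=
    { H := A
      μ := μ
      act_mul := by
        intro h a b
        refine x₀.injective ?_
        change x₀ _ = x₀ _
        rw [hμ, evalAt_apply_mul, ← hι.boxProd_comul]
        change evalAt₂ ρ x₀ a b (boxProd ι ι (hι.comul h)) =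
          x₀ (LinearMap.mul' K L (TensorProduct.map _ _ (hι.comul h)))
        generalize hι.comul h = t
        induction t with
        | zero => simp
        | add s t hs ht => simp only [map_add, hs, ht]
        | tmul c d =>
          rw [boxProd_tmul, evalAt₂_mul]
          simp [hμ]
      act_one := by
        intro h
        refine x₀.injective ?_
        change x₀ _ = x₀ _
        rw [hμ, evalAt_apply_one, AlgHom.commutes]
        exact (hι.algebraMap_counit h).symm
      bijective := bijective_hopfGaloisMap_of_form ρ hι hreg hμ }
  let Φ₀ : E ⊗[K] A →ₐ[E] MonoidAlgebra E N :=
    Algebra.TensorProduct.lift (Algebra.ofId E _) ι fun _ _ => Commute.all _ _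
  have hΦ₀ : ∀ e a, Φ₀ (e ⊗ₜ a) = e • ι a := by
    intro e a; simp [Φ₀, Algebra.smul_def]
  have hΦ₀bij : Function.Bijective Φ₀ := by
    have : ⇑Φ₀ = hι.isBaseChange.equiv := by
      ext1 t
      induction t with
      | zero => simp
      | add s t hs ht => simp only [map_add, hs, ht]
      | tmul c d => rw [hΦ₀, hι.isBaseChange.equiv_tmul]; rfl
    rw [this]
    exact hι.isBaseChange.equiv.bijective
  let Φ : E ⊗[K] A ≃ₐc[E] MonoidAlgebra E N :=
    BialgEquiv.ofAlgEquiv (AlgEquiv.ofBijective Φ₀ hΦ₀bij)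
      (by
        refine AlgHom.ext fun z => ?_
        change Coalgebra.counit (R := E) (Φ₀ z) = Coalgebra.counit (R := E) z
        induction z with
        | zero => simp
        | add s t hs ht => simp only [map_add, hs, ht]
        | tmul e a =>
          rw [hΦ₀, map_smul, ← hι.algebraMap_counit, TensorProduct.counit_tmul, smul_eq_mul,
            mul_comm, ← Algebra.smul_def]
          rfl)
      (by
        refine AlgHom.ext fun z => (tensorEquiv E).injective ?_
        change tensorEquiv E (Algebra.TensorProduct.map Φ₀ Φ₀ (Coalgebra.comul (R := E) z)) =
          tensorEquiv E (Coalgebra.comul (R := E) (Φ₀ z))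
        rw [tensorEquiv_comul (K := K)]
        induction z with
        | zero => simp
        | add s t hs ht => simp only [map_add, hs, ht]
        | tmul e a =>
          rw [hΦ₀, TensorProduct.comul_tmul, CommSemiring.comul_apply,
            ← (tensorEquiv_comul (K := K) (e • ι a)), map_smul, map_smul,
              tensorEquiv_comul (K := K),
            ← hι.boxProd_comul]
          change tensorEquiv E (Algebra.TensorProduct.map Φ₀ Φ₀
            (TensorProduct.AlgebraTensorModule.tensorTensorTensorComm K E K E E E A A
              ((1 ⊗ₜ[E] e) ⊗ₜ[K] hι.comul a))) = _
          generalize hι.comul a = t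
          induction t with
          | zero => simp
          | add s t hs ht => simp only [map_add, TensorProduct.tmul_add, smul_add, hs, ht]
          | tmul c d =>
            rw [TensorProduct.AlgebraTensorModule.tensorTensorTensorComm_tmul,
              Algebra.TensorProduct.map_tmul, hΦ₀, hΦ₀, one_smul, TensorProduct.tmul_smul,
              map_smul, tensorEquiv_tmul (K := K), boxProd_tmul])
  refine ⟨S, Φ, ?_⟩
  -- Under `Φ` the precomposition action is the given action of `E[N]`, so its group-like elements
  -- induce `ρ`.
  have hpre : ∀ (x : L →ₐ[K] E) z, S.precomp x.toLinearMap z = evalAt ρ x (Φ z) := by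
    intro x z
    induction z with
    | zero => simp
    | add s t hs ht => simp only [map_add, hs, ht]
    | tmul e h =>
      rw [HopfGaloisStructure.precomp_tmul]
      change _ = evalAt ρ x (Φ₀ (e ⊗ₜ h))
      rw [hΦ₀, map_smul]
      congr 1
      ext a
      exact hμ h x a
  ext n x : 2
  apply AlgHom.toLinearMap_injective
  rw [HopfGaloisStructure.permHom_apply, hpre]
  change evalAt ρ x (Φ (Φ.symm _)) = _
  rw [BialgEquiv.apply_symm_apply]
  simp

end FormAction

/-! ### The Greither–Pareigis correspondence -/

section Classification

open MonoidAlgebra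

variable {K : Type u} {L : Type v} {E : Type w} [Field K] [Field L] [Field E]
  [Algebra K L] [Algebra K E] [FiniteDimensional K L] [Algebra.IsSeparable K L]
  [IsNormalClosure K L E] {N : Type*} [CommGroup N]

/-- Every regular group of permutations of the embeddings of `L` normalised by the Galois group
arises from a Hopf Galois structure. -/
lemma exists_permHom_eq (ρ : N →* Equiv.Perm (L →ₐ[K] E))
    (hreg : ∀ x, Function.Bijective fun n => ρ n x)
    (hnorm : ∀ g n, galPerm K L E g * ρ n * (galPerm K L E g)⁻¹ ∈ ρ.range) :
    ∃ (S : HopfGaloisStructure K L) (Φ : (E ⊗[K] S.H) ≃ₐc[E] MonoidAlgebra E N),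
      S.permHom Φ = ρ := by
  have := isGalois_of_isNormalClosure (K := K) (L := L) (E := E)
  have := finiteDimensional_of_isNormalClosure (K := K) (L := L) (E := E)
  obtain ⟨x₀⟩ := nonempty_algHom_of_isNormalClosure (K := K) (L := L) (E := E)
  have hρinj : Function.Injective ρ := fun m n h =>
    (hreg x₀).1 (congrArg (fun π : Equiv.Perm _ => π x₀) h)
  have : Finite N := Finite.of_injective _ (hreg x₀).1
  choose t ht using hnorm
  -- Conjugation, transported back to `N` through the injective `ρ`.
  let θ : Gal(E/K) → N →* N := fun g =>
    { toFun := t g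
      map_one' := hρinj (by rw [ht]; simp)
      map_mul' := fun m n => hρinj (by simp only [ht, map_mul]; group) }
  have hθ : ∀ g n, ρ (θ g n) = galPerm K L E g * ρ n * (galPerm K L E g)⁻¹ := ht
  have hρ : ∀ g n x, galPerm K L E g (ρ n x) = ρ (θ g n) (galPerm K L E g x) := by
    intro g n x
    rw [hθ, Equiv.Perm.mul_apply, Equiv.Perm.mul_apply, Equiv.Perm.inv_def, Equiv.symm_apply_apply]
  have hθmul : ∀ g h n, θ (g * h) n = θ g (θ h n) := fun g h n => hρinj (by
    simp only [hθ, map_mul]; group)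
  have hθone : ∀ n, θ 1 n = n := fun n => hρinj (by simp [hθ])
  let A : Subalgebra K (MonoidAlgebra E N) :=
    { carrier := {c | ∀ g, semilinearMap g (θ g) c = c}
      mul_mem' := fun ha hb g => by rw [map_mul, ha, hb]
      add_mem' := fun ha hb g => by rw [map_add, ha, hb]
      algebraMap_mem' := fun r g => AlgHom.commutes _ r }
  have hA : IsBaseChange E A.toSubmodule.subtype := by
    have hfin : Module.Finite E (MonoidAlgebra E N) :=
      Module.Finite.equiv (coeffLinearEquiv E : MonoidAlgebra E N ≃ₗ[E] (N →₀ E)).symm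
    refine exists_basis_of_semilinear
      (fun g => (semilinearMap g (θ g)).toLinearMap.toAddMonoidHom)
      (fun g e v => semilinearMap_smul g (θ g) e v) (fun g h v => ?_) (fun v => ?_) _
      (fun v => Iff.rfl)
    · change semilinearMap (g * h) (θ (g * h)) v =
        semilinearMap g (θ g) (semilinearMap h (θ h) v)
      induction v using MonoidAlgebra.induction_linear with
      | zero => simp
      | add a b ha hb => simp only [map_add, ha, hb]
      | single n e => simp [hθmul]
    · change semilinearMap 1 (θ 1) v = v
      induction v using MonoidAlgebra.induction_linear with
      | zero => simp
      | add a b ha hb => simp only [map_add, ha, hb]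
      | single n e => simp [hθone]
  have hfinA : Module.Finite K A := by
    have : Module.Finite E (MonoidAlgebra E N) :=
      Module.Finite.equiv (coeffLinearEquiv E : MonoidAlgebra E N ≃ₗ[E] (N →₀ E)).symm
    have : Module.Finite K (MonoidAlgebra E N) := Module.Finite.trans E _
    exact inferInstanceAs (Module.Finite K A.toSubmodule)
  -- The invariants need not live in the universe of `K`, as the Hopf algebra of a structure must;
  -- finite dimensionality allows shrinking.
  have : Small.{u} A := ⟨_, ⟨(Module.finBasis K A).equivFun.toEquiv⟩⟩
  let e : Shrink.{u} A ≃ₐ[K] A := Shrink.algEquiv K A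
  have : Module.Finite K (Shrink.{u} A) := Module.Finite.equiv e.symm.toLinearEquiv
  have hι : IsGroupAlgebraForm θ (A.val.comp e.toAlgHom) :=
    { isBaseChange := IsBaseChange.comp_equiv e.toLinearEquiv A.toSubmodule.subtype hA
      fixed := fun g a => (e a).2 g }
  exact exists_hopfGaloisStructure_of_form ρ hι hρ hreg

/-- The regular groups of permutations of the embeddings of `L` which are isomorphic to `N` and
normalised by the Galois group. -/
def stableRegularSubgroups (K : Type u) (L : Type v) (E : Type w) [Field K] [Field L] [Field E]
    [Algebra K L] [Algebra K E] (N : Type*) [Group N] : Set (Subgroup (Equiv.Perm (L →ₐ[K] E))) :=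
  {P | P.IsRegular ∧ (∀ (g : Gal(E/K)), ∀ π ∈ P, galPerm K L E g * π * (galPerm K L E g)⁻¹ ∈ P) ∧
    Nonempty (N ≃* P)}

namespace HopfGaloisStructure

lemma range_permHom_mem (S : HopfGaloisStructure K L)
    (Φ : (E ⊗[K] S.H) ≃ₐc[E] MonoidAlgebra E N) :
    (S.permHom Φ).range ∈ stableRegularSubgroups K L E N :=
  ⟨S.isRegular_range_permHom Φ, fun g _ hπ => S.galPerm_conj_mem_range_permHom Φ g hπ,
    ⟨MonoidHom.ofInjective (S.permHom_injective Φ)⟩⟩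

lemma range_permHom_eq_iff {S T : HopfGaloisStructure K L}
    (Φ : (E ⊗[K] S.H) ≃ₐc[E] MonoidAlgebra E N) (Ψ : (E ⊗[K] T.H) ≃ₐc[E] MonoidAlgebra E N) :
    (S.permHom Φ).range = (T.permHom Ψ).range ↔ S.Iso T := by
  constructor
  · intro h
    apply iso_of_range_eq
    ext φ
    rw [mem_range_μ_iff (E := E), mem_range_μ_iff (E := E), range_act_eq_span S Φ,
      range_act_eq_span T Ψ, h]
  · intro h
    ext π
    rw [mem_range_permHom_iff, mem_range_permHom_iff, h.range_act_eq]

/-- The theorem of Greither and Pareigis, for abelian types. -/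
theorem numberOfType_eq_ncard :
    numberOfType K L E N = (stableRegularSubgroups K L E N).ncard := by
  rw [numberOfType, ← Nat.card_coe_set_eq]
  have hrep : ∀ c : {c : Quotient (setoid K L) //
      ∃ S : HopfGaloisStructure K L, Quotient.mk (setoid K L) S = c ∧ S.IsOfType E N},
      ∃ (S : HopfGaloisStructure K L) (_ : (E ⊗[K] S.H) ≃ₐc[E] MonoidAlgebra E N),
        Quotient.mk (setoid K L) S = c := fun ⟨_, S, hS, ⟨Φ⟩⟩ => ⟨S, Φ, hS⟩
  choose S Φ hS using hrep
  refine Nat.card_congr (Equiv.ofBijective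
    (fun c => (⟨_, (S c).range_permHom_mem (Φ c)⟩ : stableRegularSubgroups K L E N)) ⟨?_, ?_⟩)
  · intro c d h
    apply Subtype.ext
    rw [← hS c, ← hS d]
    exact Quotient.sound ((range_permHom_eq_iff (Φ c) (Φ d)).1 (congrArg Subtype.val h))
  · rintro ⟨P, hreg, hnorm, ⟨e⟩⟩
    have hrange : (P.subtype.comp e.toMonoidHom).range = P := by
      rw [MonoidHom.range_comp, MonoidHom.range_eq_top.2 e.surjective, ← MonoidHom.range_eq_map,
        Subgroup.range_subtype]
    obtain ⟨T, Ψ, hT⟩ := exists_permHom_eq (P.subtype.comp e.toMonoidHom)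
      (fun x => (hreg x).comp e.bijective)
      (fun g n => by rw [hrange]; exact hnorm g _ (e n).2)
    refine ⟨⟨Quotient.mk _ T, T, rfl, ⟨Ψ⟩⟩, Subtype.ext ?_⟩
    have h : Quotient.mk (setoid K L) (S ⟨Quotient.mk _ T, T, rfl, ⟨Ψ⟩⟩) = Quotient.mk _ T := hS _
    have hiso : (S ⟨Quotient.mk _ T, T, rfl, ⟨Ψ⟩⟩).Iso T := Quotient.exact h
    exact ((range_permHom_eq_iff _ Ψ).2 hiso).trans (by rw [hT, hrange])

end HopfGaloisStructure

end Classification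

/-! ### Geometric sums modulo an odd prime power -/

section NumberTheory

open Finset

/-- Lifting the exponent gives `v_p(a ^ d - 1) = v_p(a - 1) + v_p(d)`, so a geometric sum of length
`d` has the valuation of `d`. Two sums differ by such a sum times a power of `a`, prime to `p`. The
case `a = 1` is separate since `v_p(0)` is infinite. -/
lemma geom_sum_modEq_iff {p n a : ℕ} (hp : p.Prime) (hp_odd : Odd p) (ha : a ≡ 1 [MOD p])
    (i j : ℕ) :
    ∑ k ∈ range i, a ^ k ≡ ∑ k ∈ range j, a ^ k [MOD p ^ n] ↔ i ≡ j [MOD p ^ n] := by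
  have hpa : ¬ p ∣ a := fun h => hp.one_lt.ne' (Nat.dvd_one.1
    ((Nat.modEq_zero_iff_dvd.1 (ha.symm.trans (Nat.modEq_zero_iff_dvd.2 h)))))
  have ha0 : 1 ≤ a := Nat.one_le_iff_ne_zero.2 fun h => hpa (h ▸ dvd_zero p)
  have hdvd : ∀ d : ℕ, p ^ n ∣ ∑ k ∈ range d, a ^ k ↔ p ^ n ∣ d := by
    intro d
    rcases ha0.eq_or_lt with rfl | ha1
    · simp
    · rw [pow_dvd_iff_le_emultiplicity, pow_dvd_iff_le_emultiplicity]
      have hpa1 : p ∣ a - 1 := (Nat.modEq_iff_dvd' ha0).1 ha.symm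
      have h1 := Nat.emultiplicity_pow_sub_pow hp hp_odd hpa1 hpa d
      have h2 : a ^ d - 1 ^ d = (a - 1) * ∑ k ∈ range d, a ^ k := by
        obtain ⟨b, rfl⟩ := Nat.exists_eq_add_of_le' ha0
        rw [one_pow, ← geom_sum_mul_add b d, Nat.add_sub_cancel, Nat.add_sub_cancel, mul_comm]
      rw [h2, emultiplicity_mul hp.prime] at h1
      have hfin : emultiplicity p (a - 1) ≠ ⊤ := by
        rw [ne_eq, emultiplicity_eq_top, not_not]
        exact Nat.finiteMultiplicity_iff.2 ⟨hp.ne_one, by omega⟩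
      rw [ENat.add_right_injective_of_ne_top hfin h1]
  have key : ∀ i j, i ≤ j →
      (∑ k ∈ range i, a ^ k ≡ ∑ k ∈ range j, a ^ k [MOD p ^ n] ↔ i ≡ j [MOD p ^ n]) := by
    intro i j hij
    obtain ⟨d, rfl⟩ := Nat.exists_eq_add_of_le hij
    rw [Nat.modEq_iff_dvd' hij, sum_range_add]
    rw [Nat.modEq_iff_dvd' (Nat.le_add_right _ _), Nat.add_sub_cancel_left,
      Nat.add_sub_cancel_left, ← hdvd d]
    simp only [pow_add, ← mul_sum]
    exact (Nat.Coprime.pow _ _ ((Nat.Prime.coprime_iff_not_dvd hp).2 hpa)).dvd_mul_left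
  rcases le_total i j with h | h
  · exact key i j h
  · exact ⟨fun H => ((key j i h).1 H.symm).symm, fun H => ((key j i h).2 H.symm).symm⟩

end NumberTheory

/-! ### Regular cyclic subgroups normalised by a transitive cyclic group -/

section RegularSubgroups

open Finset

variable {X : Type*} {σ : Equiv.Perm X}

lemma pow_apply_eq_pow_apply_iff [Finite X] (hσ : ∀ x y, ∃ k : ℕ, (σ ^ k) x = y) (x : X) (i j : ℕ) :
    (σ ^ i) x = (σ ^ j) x ↔ i ≡ j [MOD Nat.card X] := by
  have horb : MulAction.orbit (Subgroup.zpowers σ) x = Set.univ := by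
    refine Set.eq_univ_of_forall fun y => ?_
    obtain ⟨k, hk⟩ := hσ x y
    exact ⟨⟨σ ^ k, k, by simp⟩, hk⟩
  have hmin : Function.minimalPeriod (σ • ·) x = Nat.card X := by
    have := Fintype.ofFinite (MulAction.orbit (Subgroup.zpowers σ) x)
    rw [MulAction.minimalPeriod_eq_card, ← Nat.card_eq_fintype_card, horb, Nat.card_univ]
  have key : ∀ i j, i ≤ j → ((σ ^ i) x = (σ ^ j) x ↔ i ≡ j [MOD Nat.card X]) := by
    intro i j hij
    obtain ⟨d, rfl⟩ := Nat.exists_eq_add_of_le hij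
    rw [Nat.modEq_iff_dvd' hij, Nat.add_sub_cancel_left, ← hmin,
      ← MulAction.pow_smul_eq_iff_minimalPeriod_dvd, pow_add, Equiv.Perm.mul_apply,
      (σ ^ i).injective.eq_iff]
    exact eq_comm
  rcases le_total i j with h | h
  · exact key i j h
  · exact ⟨fun H => ((key j i h).1 H.symm).symm, fun H => ((key j i h).2 H.symm).symm⟩

lemma exists_conj_eq_pow {G : Type*} [Group G] {σ : G} (P : Subgroup G) [IsCyclic P] [Finite P]
    (hP : ∀ ν ∈ P, σ * ν * σ⁻¹ ∈ P) : ∃ a : ℕ, ∀ ν ∈ P, σ * ν * σ⁻¹ = ν ^ a := by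
  obtain ⟨⟨g, hg⟩, hgen⟩ := IsCyclic.exists_monoid_generator (α := P)
  obtain ⟨a, ha⟩ := Submonoid.mem_powers_iff _ _ |>.1 (hgen ⟨_, hP g hg⟩)
  have ha' : σ * g * σ⁻¹ = g ^ a := congrArg Subtype.val ha.symm
  refine ⟨a, fun ν hν => ?_⟩
  obtain ⟨j, hj⟩ := Submonoid.mem_powers_iff _ _ |>.1 (hgen ⟨ν, hν⟩)
  have hj' : g ^ j = ν := congrArg Subtype.val hj
  rw [← hj', ← conj_pow, ha', ← pow_mul, ← pow_mul, mul_comm]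

lemma pow_conj_eq_pow {G : Type*} [Group G] {σ : G} {P : Subgroup G} {a : ℕ}
    (hP : ∀ ν ∈ P, σ * ν * σ⁻¹ = ν ^ a) (k : ℕ) : ∀ ν ∈ P, σ ^ k * ν * (σ ^ k)⁻¹ = ν ^ a ^ k := by
  induction k with
  | zero => simp
  | succ k ih =>
    intro ν hν
    have : σ ^ (k + 1) * ν * (σ ^ (k + 1))⁻¹ = σ * (σ ^ k * ν * (σ ^ k)⁻¹) * σ⁻¹ := by
      rw [pow_succ']; group
    rw [this, ih ν hν, ← conj_pow, hP ν hν, ← pow_mul, pow_succ']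

namespace Subgroup.IsRegular

variable {P Q : Subgroup (Equiv.Perm X)}

lemma card_eq (hP : P.IsRegular) [Nonempty X] : Nat.card P = Nat.card X :=
  Nat.card_congr (Equiv.ofBijective _ (hP (Classical.arbitrary X)))

lemma eq_of_apply_eq (hP : P.IsRegular) {x : X} {π ν : Equiv.Perm X} (hπ : π ∈ P) (hν : ν ∈ P)
    (h : π x = ν x) : π = ν :=
  congrArg Subtype.val ((hP x).1 (a₁ := ⟨π, hπ⟩) (a₂ := ⟨ν, hν⟩) h)

/-- Moving `σ` past `η ^ s` gives `σ (η ^ s x) = η ^ (a * s) (σ x) = η ^ (a * s + 1) x`, the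
recursion of the geometric sums. -/
lemma pow_apply_eq {a : ℕ} (hP : ∀ ν ∈ P, σ * ν * σ⁻¹ = ν ^ a) {x : X} {η : Equiv.Perm X}
    (hη : η ∈ P) (h : η x = σ x) (i : ℕ) : (σ ^ i) x = (η ^ ∑ k ∈ range i, a ^ k) x := by
  induction i with
  | zero => simp
  | succ i ih =>
    have h1 := hP _ (P.pow_mem hη (∑ k ∈ range i, a ^ k))
    rw [mul_inv_eq_iff_eq_mul] at h1
    rw [pow_succ', Equiv.Perm.mul_apply, ih, ← Equiv.Perm.mul_apply, h1, geom_sum_succ,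
      Equiv.Perm.mul_apply, ← h, ← pow_mul, pow_succ, Equiv.Perm.mul_apply, mul_comm a]

lemma eq_zpowers (hP : P.IsRegular) {a : ℕ} (hPa : ∀ ν ∈ P, σ * ν * σ⁻¹ = ν ^ a)
    (hσ : ∀ x y, ∃ k : ℕ, (σ ^ k) x = y) {x : X} {η : Equiv.Perm X} (hη : η ∈ P)
    (h : η x = σ x) : P = Subgroup.zpowers η := by
  refine le_antisymm (fun π hπ => ?_) ((Subgroup.zpowers_le).2 hη)
  obtain ⟨i, hi⟩ := hσ x (π x)
  rw [pow_apply_eq hPa hη h] at hi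
  rw [hP.eq_of_apply_eq hπ (P.pow_mem hη _) hi.symm]
  exact Subgroup.npow_mem_zpowers _ _

/-- A regular subgroup normalised by a transitive cyclic group `⟨σ⟩` is determined by the power
map that conjugation by `σ` induces on it. -/
lemma eq_of_conj_eq_pow [Nonempty X] (hP : P.IsRegular) (hQ : Q.IsRegular) {a : ℕ}
    (hPa : ∀ ν ∈ P, σ * ν * σ⁻¹ = ν ^ a) (hQa : ∀ ν ∈ Q, σ * ν * σ⁻¹ = ν ^ a)
    (hσ : ∀ x y, ∃ k : ℕ, (σ ^ k) x = y) : P = Q := by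
  obtain ⟨x⟩ := ‹Nonempty X›
  obtain ⟨⟨η, hη⟩, hηx⟩ := (hP x).2 (σ x)
  obtain ⟨⟨ζ, hζ⟩, hζx⟩ := (hQ x).2 (σ x)
  have hPz := hP.eq_zpowers hPa hσ hη hηx
  have hQz := hQ.eq_zpowers hQa hσ hζ hζx
  have hηo : orderOf η = Nat.card X := by
    rw [← Nat.card_zpowers, ← hPz, hP.card_eq]
  have hζo : orderOf ζ = Nat.card X := by
    rw [← Nat.card_zpowers, ← hQz, hQ.card_eq]
  -- Some `σ ^ i x` equals `η ^ k x`. The geometric sum for `i` is then congruent to `k` modulo the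
  -- common order of `η` and `ζ`, and the same `i` computes `ζ ^ k x`.
  have hk : ∀ k : ℕ, (η ^ k) x = (ζ ^ k) x := by
    intro k
    obtain ⟨i, hi⟩ := hσ x ((η ^ k) x)
    have h1 := hi
    rw [pow_apply_eq hPa hη hηx] at h1
    have h2 := hP.eq_of_apply_eq (P.pow_mem hη _) (P.pow_mem hη _) h1
    rw [pow_eq_pow_iff_modEq, hηo, ← hζo, ← pow_eq_pow_iff_modEq] at h2
    rw [← hi, pow_apply_eq hQa hζ hζx, h2]
  have : η = ζ := by
    ext y
    obtain ⟨i, rfl⟩ := hσ x y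
    rw [pow_apply_eq hPa hη hηx, ← Equiv.Perm.mul_apply, ← pow_succ', hk, pow_succ',
      Equiv.Perm.mul_apply, ← hk]
  rw [hPz, hQz, this]

end Subgroup.IsRegular

/-- Existence of regular cyclic subgroups on which a transitive cyclic group of odd prime power
order acts through a given power map. -/
lemma exists_isRegular_conj_eq_pow [Finite X] {p n a : ℕ} (hp : p.Prime) (hp_odd : Odd p)
    (ha : a ≡ 1 [MOD p]) (hX : Nat.card X = p ^ n) (hσ : ∀ x y, ∃ k : ℕ, (σ ^ k) x = y) :
    ∃ P : Subgroup (Equiv.Perm X), P.IsRegular ∧ Nonempty (Multiplicative (ZMod (p ^ n)) ≃* P) ∧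
      ∀ ν ∈ P, σ * ν * σ⁻¹ = ν ^ a := by
  have hpos : p ^ n ≠ 0 := pow_ne_zero _ hp.ne_zero
  have : NeZero (p ^ n) := ⟨hpos⟩
  have : Nonempty X := (Nat.card_pos_iff.1 (hX ▸ Nat.pos_of_ne_zero hpos)).1
  obtain ⟨x₀⟩ := this
  choose k hk using hσ x₀
  have hiff := pow_apply_eq_pow_apply_iff hσ x₀
  rw [hX] at hiff
  -- A coordinate in which `σ` becomes the affine map `z ↦ a * z + 1`; the group sought consists of
  -- the translations.
  let e : X → ZMod (p ^ n) := fun x => ((∑ i ∈ range (k x), a ^ i : ℕ) : ZMod (p ^ n))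
  have he : ∀ i : ℕ, e ((σ ^ i) x₀) = ((∑ j ∈ range i, a ^ j : ℕ) : ZMod (p ^ n)) := by
    intro i
    rw [ZMod.natCast_eq_natCast_iff, geom_sum_modEq_iff hp hp_odd ha, ← hiff, hk]
  have hebij : Function.Bijective e := by
    refine (Nat.bijective_iff_injective_and_card _).2 ⟨fun x y hxy => ?_, by rw [hX, Nat.card_zmod]⟩
    rw [ZMod.natCast_eq_natCast_iff, geom_sum_modEq_iff hp hp_odd ha, ← hiff, hk, hk] at hxy
    exact hxy
  let ε := Equiv.ofBijective e hebij
  have hε : ∀ x, ε (σ x) = a * ε x + 1 := by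
    intro x
    rw [← hk x, ← Equiv.Perm.mul_apply, ← pow_succ']
    change e _ = a * e _ + 1
    rw [he, he, geom_sum_succ]
    push_cast
    rfl
  let act : MulAction (Multiplicative (ZMod (p ^ n))) X :=
    { smul m x := ε.symm (m.toAdd + ε x)
      one_smul x := by
        change ε.symm (0 + ε x) = x
        simp
      mul_smul l m x := by
        change ε.symm (l.toAdd + m.toAdd + ε x) = ε.symm (l.toAdd + ε (ε.symm (m.toAdd + ε x)))
        rw [ε.apply_symm_apply, add_assoc] }
  let ρ : Multiplicative (ZMod (p ^ n)) →* Equiv.Perm X := MulAction.toPermHom _ X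
  have hρ : ∀ m x, ε (ρ m x) = m.toAdd + ε x := fun m x => ε.apply_symm_apply _
  have hρinj : ∀ x, Function.Injective fun m => ρ m x := by
    intro x l m h
    have h1 := congrArg ε h
    simp only [hρ] at h1
    exact Multiplicative.toAdd.injective (add_right_cancel h1)
  refine ⟨ρ.range, fun x => ⟨?_, fun y => ?_⟩,
    ⟨MonoidHom.ofInjective (f := ρ) fun l m h => hρinj x₀ (congrArg (· x₀) h)⟩, ?_⟩
  · rintro ⟨_, l, rfl⟩ ⟨_, m, rfl⟩ h
    obtain rfl := hρinj x h
    rfl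
  · refine ⟨⟨ρ (Multiplicative.ofAdd (ε y - ε x)), _, rfl⟩, ε.injective ?_⟩
    change ε (ρ _ x) = _
    rw [hρ]
    simp
  · rintro _ ⟨m, rfl⟩
    rw [mul_inv_eq_iff_eq_mul, ← map_pow]
    ext x
    apply ε.injective
    rw [Equiv.Perm.mul_apply, Equiv.Perm.mul_apply, hε, hρ, hρ, hε, toAdd_pow, nsmul_eq_mul]
    ring

lemma exists_orderOf_eq {q : ℕ} {G : Type*} [Group G] {P : Subgroup G}
    (e : Multiplicative (ZMod q) ≃* P) : ∃ ν ∈ P, orderOf ν = q := by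
  refine ⟨e (Multiplicative.ofAdd 1), (e _).2, ?_⟩
  rw [Subgroup.orderOf_coe, MulEquiv.orderOf_eq, orderOf_ofAdd_eq_addOrderOf, ZMod.addOrderOf_one]

/-- The number of regular cyclic subgroups normalised by a transitive cyclic group of odd prime
power order. -/
theorem ncard_isRegular_stable_of_cyclic [Finite X] {p n : ℕ} (hp : p.Prime) (hp_odd : Odd p)
    (hn : n ≠ 0) (hX : Nat.card X = p ^ n) (hσ : ∀ x y, ∃ k : ℕ, (σ ^ k) x = y) :
    {P : Subgroup (Equiv.Perm X) | P.IsRegular ∧ (∀ ν ∈ P, σ * ν * σ⁻¹ ∈ P) ∧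
      Nonempty (Multiplicative (ZMod (p ^ n)) ≃* P)}.ncard = p ^ (n - 1) := by
  have hpos : p ^ n ≠ 0 := pow_ne_zero _ hp.ne_zero
  have : Nonempty X := (Nat.card_pos_iff.1 (hX ▸ Nat.pos_of_ne_zero hpos)).1
  have hpn : p ^ n = p * p ^ (n - 1) := by rw [← pow_succ', Nat.sub_add_cancel (by omega)]
  have hc : ∀ c : ℕ, 1 + p * c ≡ 1 [MOD p] := fun c => by simp [Nat.ModEq]
  -- The exponents `1 + p * c` with `c < p ^ (n - 1)` represent all residues mod `p ^ n` that are
  -- `1` mod `p`.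
  choose P hreg hiso hconj using fun c : Fin (p ^ (n - 1)) =>
    exists_isRegular_conj_eq_pow hp hp_odd (hc c) hX hσ
  rw [← Nat.card_coe_set_eq]
  have hbij : Function.Bijective (fun c => (⟨P c, hreg c, fun ν hν => by
      rw [hconj c ν hν]; exact (P c).pow_mem hν _, hiso c⟩ :
      {P : Subgroup (Equiv.Perm X) | P.IsRegular ∧ (∀ ν ∈ P, σ * ν * σ⁻¹ ∈ P) ∧
        Nonempty (Multiplicative (ZMod (p ^ n)) ≃* P)})) := by
    constructor
    · intro c d hcd
      have hcd' : P c = P d := congrArg Subtype.val hcd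
      obtain ⟨e⟩ := hiso c
      obtain ⟨ν, hν, ho⟩ := exists_orderOf_eq e
      have h1 := hconj c ν hν
      rw [hconj d ν (hcd' ▸ hν), pow_eq_pow_iff_modEq, ho, hpn] at h1
      have h2 := Nat.ModEq.mul_left_cancel' hp.ne_zero (Nat.ModEq.add_left_cancel' 1 h1)
      exact Fin.ext (h2.symm.eq_of_lt_of_lt c.2 d.2)
    · rintro ⟨Q, hQ, hstab, ⟨e⟩⟩
      have : IsCyclic Q := isCyclic_of_surjective e e.surjective
      obtain ⟨a, ha⟩ := exists_conj_eq_pow Q hstab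
      obtain ⟨ν, hν, ho⟩ := exists_orderOf_eq e
      have hσq : σ ^ p ^ n = 1 := by
        ext x
        have := (pow_apply_eq_pow_apply_iff hσ x (p ^ n) 0).2 (by rw [hX]; simp [Nat.ModEq])
        simpa using this
      have haq : a ^ p ^ n ≡ 1 [MOD p ^ n] := by
        have h1 := pow_conj_eq_pow ha (p ^ n) ν hν
        rw [hσq, one_mul, inv_one, mul_one] at h1
        nth_rw 1 [← pow_one ν] at h1
        rw [pow_eq_pow_iff_modEq, ho] at h1
        exact h1.symm
      -- By Fermat, `a ^ p ^ n ≡ a` mod `p`.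
      have hap : a ≡ 1 [MOD p] := by
        have : Fact p.Prime := ⟨hp⟩
        have h1 := haq.of_dvd (dvd_pow_self p hn)
        rw [← ZMod.natCast_eq_natCast_iff, Nat.cast_pow, ZMod.pow_card_pow] at h1
        rwa [← ZMod.natCast_eq_natCast_iff]
      set b := a % p ^ n with hb
      have hbp : b ≡ 1 [MOD p] :=
        ((Nat.mod_modEq a (p ^ n)).of_dvd (dvd_pow_self p hn)).trans hap
      have hb1 : 1 ≤ b := by
        rw [Nat.one_le_iff_ne_zero]
        intro h0
        rw [h0] at hbp
        exact hp.one_lt.ne' (Nat.dvd_one.1 (Nat.modEq_zero_iff_dvd.1 hbp.symm))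
      obtain ⟨c, hbc⟩ := (Nat.modEq_iff_dvd' hb1).1 hbp.symm
      have hbc' : b = 1 + p * c := by omega
      have hlt : c < p ^ (n - 1) := by
        have : b < p * p ^ (n - 1) := hpn ▸ Nat.mod_lt a (Nat.pos_of_ne_zero hpos)
        exact Nat.lt_of_mul_lt_mul_left (a := p) (by omega)
      refine ⟨⟨c, hlt⟩, Subtype.ext ((hreg ⟨c, hlt⟩).eq_of_conj_eq_pow hQ
        (hconj ⟨c, hlt⟩) (fun ν hν => ?_) hσ)⟩
      rw [ha ν hν]
      change ν ^ a = ν ^ (1 + p * c)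
      rw [← hbc', hb]
      have hq : ν ^ p ^ n = 1 := by
        have h1 : Nat.card Q = p ^ n := by rw [hQ.card_eq, hX]
        rw [← h1]
        exact congrArg Subtype.val (pow_card_eq_one' (x := (⟨ν, hν⟩ : Q)))
      conv_lhs => rw [← Nat.div_add_mod a (p ^ n), pow_add, pow_mul, hq, one_pow, one_mul]
  rw [← Nat.card_congr (Equiv.ofBijective _ hbij), Nat.card_fin]

end RegularSubgroups

/-! ### Regular cyclic subgroups normalised by a semidirect product -/

section Semidirect

variable {X : Type*} {p n D : ℕ}
  {φ : Multiplicative (ZMod D) →* MulAut (Multiplicative (ZMod (p ^ n)))}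

lemma ofAdd_one_pow_surjective {m : ℕ} [NeZero m] (c : Multiplicative (ZMod m)) :
    ∃ k : ℕ, c = (Multiplicative.ofAdd 1) ^ k := by
  refine ⟨c.toAdd.val, ?_⟩
  rw [← ofAdd_nsmul, nsmul_one, ZMod.natCast_zmod_val, ofAdd_toAdd]

variable (ψ : Multiplicative (ZMod (p ^ n)) ⋊[φ] Multiplicative (ZMod D) →* Equiv.Perm X)

/-- Point stabilisers have order `D`, prime to `p`, so they meet the normal subgroup of order `p ^
n` trivially. -/
lemma bijective_apply_inl [Finite X] (hp : p.Prime) (hD : D.Coprime p) (hD0 : D ≠ 0)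
    (hX : Nat.card X = p ^ n) (htrans : ∀ x y, ∃ γ, ψ γ x = y) (x : X) :
    Function.Bijective fun c => ψ (SemidirectProduct.inl c) x := by
  have : NeZero (p ^ n) := ⟨pow_ne_zero _ hp.ne_zero⟩
  have : NeZero D := ⟨hD0⟩
  refine (Nat.bijective_iff_injective_and_card _).2 ⟨?_, by
    rw [hX, Nat.card_congr Multiplicative.toAdd, Nat.card_zmod]⟩
  let act := MulAction.compHom X ψ
  have hstab : Nat.card (MulAction.stabilizer
      (Multiplicative (ZMod (p ^ n)) ⋊[φ] Multiplicative (ZMod D)) x) = D := by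
    have horb : MulAction.orbit
        (Multiplicative (ZMod (p ^ n)) ⋊[φ] Multiplicative (ZMod D)) x = Set.univ :=
      Set.eq_univ_of_forall fun y => htrans x y
    have h := Nat.card_congr (MulAction.orbitProdStabilizerEquivGroup
      (Multiplicative (ZMod (p ^ n)) ⋊[φ] Multiplicative (ZMod D)) x)
    rw [Nat.card_prod, horb, Nat.card_univ, hX, SemidirectProduct.card,
      Nat.card_congr Multiplicative.toAdd, Nat.card_zmod, Nat.card_congr Multiplicative.toAdd,
      Nat.card_zmod] at h
    exact Nat.eq_of_mul_eq_mul_left (Nat.pos_of_ne_zero (NeZero.ne _)) h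
  intro c d hcd
  have hcd' : ψ (SemidirectProduct.inl (d⁻¹ * c)) x = x := by
    rw [map_mul, map_inv, map_mul, map_inv, Equiv.Perm.mul_apply, Equiv.Perm.inv_eq_iff_eq]
    exact hcd
  have h1 : orderOf (SemidirectProduct.inl (φ := φ) (d⁻¹ * c)) ∣ D :=
    (Subgroup.orderOf_dvd_natCard (MulAction.stabilizer _ x) hcd').trans hstab.dvd
  rw [orderOf_injective _ SemidirectProduct.inl_injective] at h1
  have h2 : orderOf (d⁻¹ * c) ∣ p ^ n := by
    have := orderOf_dvd_natCard (d⁻¹ * c)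
    rwa [Nat.card_congr Multiplicative.toAdd, Nat.card_zmod] at this
  have h3 := Nat.eq_one_of_dvd_coprimes (hD.pow_right n) h1 h2
  rw [orderOf_eq_one_iff, inv_mul_eq_one] at h3
  exact h3.symm

/-- The action of the complement on the normal cyclic subgroup is given by multiplication with
an integer which is not congruent to `1` modulo `p`. -/
lemma exists_conj_inl_eq_pow [Finite X] (hp : p.Prime) (hn : n ≠ 0) (hD : D.Coprime p) (hD1 : 1 < D)
    (hX : Nat.card X = p ^ n) (htrans : ∀ x y, ∃ γ, ψ γ x = y) (hψ : Function.Injective ψ) :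
    ∃ u : ℕ, 1 ≤ u ∧ ¬ p ∣ u - 1 ∧
      (SemidirectProduct.inr (Multiplicative.ofAdd 1) *
        SemidirectProduct.inl (Multiplicative.ofAdd 1) *
        (SemidirectProduct.inr (Multiplicative.ofAdd 1))⁻¹ :
        Multiplicative (ZMod (p ^ n)) ⋊[φ] Multiplicative (ZMod D)) =
      (SemidirectProduct.inl (Multiplicative.ofAdd 1)) ^ u := by
  have hpn : p ^ n ≠ 0 := pow_ne_zero _ hp.ne_zero
  have : NeZero (p ^ n) := ⟨hpn⟩
  have : NeZero D := ⟨by omega⟩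
  have hbij := bijective_apply_inl ψ hp hD (by omega) hX htrans
  set s : Multiplicative (ZMod (p ^ n)) := Multiplicative.ofAdd 1 with hs
  set t : Multiplicative (ZMod D) := Multiplicative.ofAdd 1 with ht
  obtain ⟨k, hk⟩ := ofAdd_one_pow_surjective (φ t s)
  have hsq : s ^ p ^ n = 1 := by
    rw [hs, ← ofAdd_nsmul, nsmul_one, ZMod.natCast_self, ofAdd_zero]
  have htD : t ^ D = 1 := by
    rw [ht, ← ofAdd_nsmul, nsmul_one, ZMod.natCast_self, ofAdd_zero]
  -- Adding `p ^ n` does not change the power and ensures `1 ≤ u`, so that `u - 1` is a true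
  -- difference.
  have hu : φ t s = s ^ (k + p ^ n) := by rw [hk, pow_add, hsq, mul_one]
  refine ⟨k + p ^ n, by omega, fun hdvd => ?_, ?_⟩
  swap
  · rw [← map_inv SemidirectProduct.inr, ← SemidirectProduct.inl_aut, hu, map_pow]
  set u := k + p ^ n with hudef
  have hu1 : 1 ≤ u := by omega
  have hso : orderOf s = p ^ n := by
    rw [hs, orderOf_ofAdd_eq_addOrderOf, ZMod.addOrderOf_one]
  have hpow : ∀ j : ℕ, (φ t ^ j) s = s ^ u ^ j := by
    intro j
    induction j with
    | zero => simp
    | succ j ih => rw [pow_succ', MulAut.mul_apply, ih, map_pow, hu, ← pow_mul, pow_succ']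
  have huD : (u : ZMod (p ^ n)) ^ D = 1 := by
    have h1 := hpow D
    rw [← map_pow, htD, map_one, MulAut.one_apply] at h1
    nth_rw 1 [← pow_one s] at h1
    rw [pow_eq_pow_iff_modEq, hso, ← ZMod.natCast_eq_natCast_iff] at h1
    simpa using h1.symm
  have hup : (u : ZMod (p ^ n)) ^ p ^ (n - 1) = 1 := by
    have h1 : (p : ℤ) ∣ (u : ℤ) - 1 := by
      have := Int.natCast_dvd_natCast.2 hdvd
      rwa [Nat.cast_sub hu1, Nat.cast_one] at this
    have h2 := dvd_sub_pow_of_dvd_sub h1 (n - 1)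
    rw [Nat.sub_add_cancel (by omega), one_pow] at h2
    have h3 := (ZMod.intCast_zmod_eq_zero_iff_dvd ((u : ℤ) ^ p ^ (n - 1) - 1) (p ^ n)).2
      (by exact_mod_cast h2)
    push_cast at h3
    exact sub_eq_zero.1 h3
  -- Were `p ∣ u - 1`, the order of `u` would divide both `D` and `p ^ (n - 1)`.
  have hu_one : (u : ZMod (p ^ n)) = 1 := by
    rw [← orderOf_eq_one_iff]
    exact Nat.eq_one_of_dvd_coprimes (hD.pow_right (n - 1)) (orderOf_dvd_of_pow_eq_one huD)
      (orderOf_dvd_of_pow_eq_one hup)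
  have hcomm : φ t s = s := by
    rw [hu]
    nth_rw 2 [← pow_one s]
    rw [pow_eq_pow_iff_modEq, hso, ← ZMod.natCast_eq_natCast_iff, hu_one, Nat.cast_one]
  have hcommσ : Commute (ψ (SemidirectProduct.inr t)) (ψ (SemidirectProduct.inl s)) := by
    refine Commute.map ?_ ψ
    have := SemidirectProduct.inl_aut (φ := φ) t s
    rw [hcomm] at this
    exact (eq_mul_inv_iff_mul_eq.1 (this.trans (by rw [map_inv]))).symm
  obtain ⟨x⟩ : Nonempty X := (Nat.card_pos_iff.1 (hX ▸ Nat.pos_of_ne_zero hpn)).1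
  have hgen : ∀ y, ∃ i : ℕ, (ψ (SemidirectProduct.inl s) ^ i) x = y := by
    intro y
    obtain ⟨c, hc⟩ := (hbij x).2 y
    obtain ⟨i, rfl⟩ := ofAdd_one_pow_surjective c
    exact ⟨i, by rw [← hc, ← map_pow, ← map_pow]⟩
  obtain ⟨i, hi⟩ := hgen (ψ (SemidirectProduct.inr t) x)
  -- A permutation commuting with a transitive cyclic group is determined by one value, hence
  -- belongs to that group; as `ψ` is injective and `D > 1`, this is absurd.
  have heq : ψ (SemidirectProduct.inr t) = ψ (SemidirectProduct.inl s) ^ i := by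
    ext y
    obtain ⟨j, rfl⟩ := hgen y
    rw [← Equiv.Perm.mul_apply, (hcommσ.pow_right j).eq, Equiv.Perm.mul_apply, ← hi,
      ← Equiv.Perm.mul_apply, ← Equiv.Perm.mul_apply, ← pow_add, ← pow_add, add_comm]
  rw [← map_pow, ← map_pow] at heq
  have h4 := congrArg SemidirectProduct.right (hψ heq)
  rw [SemidirectProduct.right_inr, SemidirectProduct.right_inl, ht, ← ofAdd_zero] at h4
  have h5 : (1 : ZMod D) = 0 := Multiplicative.ofAdd.injective h4
  have : Fact (1 < D) := ⟨hD1⟩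
  exact one_ne_zero h5

/-- A transitive faithful permutation group of degree `p ^ n` which is a semidirect product of a
cyclic group of order `p ^ n` and a nontrivial cyclic group of order prime to `p` normalises
exactly one regular cyclic subgroup. -/
theorem ncard_isRegular_stable_of_semidirectProduct [Finite X] (hp : p.Prime) (hn : n ≠ 0)
    (hD : D.Coprime p) (hD1 : 1 < D) (hX : Nat.card X = p ^ n)
    (htrans : ∀ x y, ∃ γ, ψ γ x = y) (hψ : Function.Injective ψ) :
    {P : Subgroup (Equiv.Perm X) | P.IsRegular ∧ (∀ γ, ∀ ν ∈ P, ψ γ * ν * (ψ γ)⁻¹ ∈ P) ∧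
      Nonempty (Multiplicative (ZMod (p ^ n)) ≃* P)}.ncard = 1 := by
  have hpn : p ^ n ≠ 0 := pow_ne_zero _ hp.ne_zero
  have : NeZero (p ^ n) := ⟨hpn⟩
  have : NeZero D := ⟨by omega⟩
  have : Nonempty X := (Nat.card_pos_iff.1 (hX ▸ Nat.pos_of_ne_zero hpn)).1
  have hbij := bijective_apply_inl ψ hp hD (by omega) hX htrans
  obtain ⟨u, hu1, hup, hu⟩ := exists_conj_inl_eq_pow ψ hp hn hD hD1 hX htrans hψ
  have hu' := congrArg ψ hu
  rw [map_mul, map_mul, map_inv, map_pow] at hu'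
  set σ := ψ (SemidirectProduct.inl (Multiplicative.ofAdd 1)) with hσdef
  set τ := ψ (SemidirectProduct.inr (Multiplicative.ofAdd 1)) with hτdef
  have hσ : ∀ x y, ∃ i : ℕ, (σ ^ i) x = y := by
    intro x y
    obtain ⟨c, hc⟩ := (hbij x).2 y
    obtain ⟨i, rfl⟩ := ofAdd_one_pow_surjective c
    exact ⟨i, by rw [← hc, hσdef, ← map_pow, ← map_pow]⟩
  have hσq : σ ^ p ^ n = 1 := by
    rw [hσdef, ← map_pow, ← map_pow, ← ofAdd_nsmul, nsmul_one, ZMod.natCast_self, ofAdd_zero,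
      map_one, map_one]
  have hreg : (ψ.comp SemidirectProduct.inl).range.IsRegular := by
    refine fun x => ⟨?_, fun y => ?_⟩
    · rintro ⟨_, l, rfl⟩ ⟨_, m, rfl⟩ h
      obtain rfl := (hbij x).1 h
      rfl
    · obtain ⟨c, hc⟩ := (hbij x).2 y
      exact ⟨⟨_, c, rfl⟩, hc⟩
  rw [Set.ncard_eq_one]
  refine ⟨(ψ.comp SemidirectProduct.inl).range, Set.eq_singleton_iff_unique_mem.2 ⟨?_, ?_⟩⟩
  · refine ⟨hreg, ?_, ⟨MonoidHom.ofInjective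
      (f := ψ.comp SemidirectProduct.inl) (hψ.comp SemidirectProduct.inl_injective)⟩⟩
    rintro γ _ ⟨c, rfl⟩
    have h1 : γ * SemidirectProduct.inl c * γ⁻¹ ∈
        (SemidirectProduct.inl (φ := φ)).range := by
      rw [SemidirectProduct.range_inl_eq_ker_rightHom, MonoidHom.mem_ker]
      simp
    obtain ⟨d, hd⟩ := h1
    refine ⟨d, ?_⟩
    rw [MonoidHom.comp_apply, hd]
    simp
  · rintro Q ⟨hQ, hstab, ⟨e⟩⟩
    have : IsCyclic Q := isCyclic_of_surjective e e.surjective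
    obtain ⟨a, ha⟩ := exists_conj_eq_pow Q (hstab (SemidirectProduct.inl (Multiplicative.ofAdd 1)))
    obtain ⟨ν, hν, ho⟩ := exists_orderOf_eq e
    have hmod : ∀ {i j : ℕ}, ν ^ i = ν ^ j → (i : ZMod (p ^ n)) = j := by
      intro i j h
      rwa [pow_eq_pow_iff_modEq, ho, ← ZMod.natCast_eq_natCast_iff] at h
    have haq : (a : ZMod (p ^ n)) ^ p ^ n = 1 := by
      have h1 := pow_conj_eq_pow ha (p ^ n) ν hν
      rw [hσq, one_mul, inv_one, mul_one] at h1
      nth_rw 1 [← pow_one ν] at h1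
      simpa using (hmod h1).symm
    have hau : (a : ZMod (p ^ n)) ^ u = a := by
      have h1 := pow_conj_eq_pow ha u ν hν
      have h2 : τ⁻¹ * ν * τ ∈ Q := by
        have := hstab (SemidirectProduct.inr (Multiplicative.ofAdd 1))⁻¹ ν hν
        rwa [map_inv, inv_inv] at this
      -- `σ ^ u` is `σ` conjugated by `τ`, and conjugation by `τ` preserves `Q` and commutes with
      -- power maps, so `σ ^ u` acts with the exponent `a` of `σ`.
      have h3 : σ ^ u * ν * (σ ^ u)⁻¹ = ν ^ a := by
        calc σ ^ u * ν * (σ ^ u)⁻¹ = τ * (σ * (τ⁻¹ * ν * τ) * σ⁻¹) * τ⁻¹ := by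
              rw [← hu']; group
          _ = τ * (τ⁻¹ * ν * τ) ^ a * τ⁻¹ := by rw [ha _ h2]
          _ = ν ^ a := by rw [← conj_pow]; congr 1; group
      rw [h3] at h1
      simpa using (hmod h1).symm
    have ha1 : (a : ZMod (p ^ n)) = 1 := by
      have hunit : IsUnit (a : ZMod (p ^ n)) := IsUnit.of_pow_eq_one haq hpn
      have h1 : (a : ZMod (p ^ n)) ^ (u - 1) = 1 := by
        apply hunit.mul_left_cancel
        rw [← pow_succ', Nat.sub_add_cancel hu1, hau, mul_one]
      -- The order of `a` divides `u - 1`, which is prime to `p`, and also `p ^ n`.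
      rw [← orderOf_eq_one_iff]
      exact Nat.eq_one_of_dvd_coprimes
        (((Nat.Prime.coprime_iff_not_dvd hp).2 hup).symm.pow_right n)
        (orderOf_dvd_of_pow_eq_one h1) (orderOf_dvd_of_pow_eq_one haq)
    refine hQ.eq_of_conj_eq_pow (Q := (ψ.comp SemidirectProduct.inl).range) (a := 1) hreg
      (fun μ hμ => ?_) ?_ hσ
    · rw [ha μ hμ]
      have hq : μ ^ p ^ n = 1 := by
        have h1 : Nat.card Q = p ^ n := by rw [hQ.card_eq, hX]
        rw [← h1]
        exact congrArg Subtype.val (pow_card_eq_one' (x := (⟨μ, hμ⟩ : Q)))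
      rw [pow_eq_pow_iff_modEq]
      have h2 : a ≡ 1 [MOD p ^ n] := by
        rw [← ZMod.natCast_eq_natCast_iff, ha1, Nat.cast_one]
      exact h2.of_dvd (orderOf_dvd_of_pow_eq_one hq)
    · rintro _ ⟨c, rfl⟩
      rw [mul_inv_eq_iff_eq_mul, pow_one, hσdef, MonoidHom.comp_apply, ← map_mul, ← map_mul,
        ← map_mul, ← map_mul, mul_comm]

end Semidirect

/-! ### Faithfulness of the Galois action and the final count -/

section Main

variable {K : Type u} {L : Type v} {E : Type w} [Field K] [Field L] [Field E]
  [Algebra K L] [Algebra K E]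

/-- The kernel fixes every image of `L` pointwise, and these images generate `E`. -/
lemma galPerm_injective [FiniteDimensional K L] [IsNormalClosure K L E] :
    Function.Injective (galPerm K L E) := by
  rw [injective_iff_map_eq_one]
  intro g hg
  have htop := (Algebra.IsAlgebraic.isNormalClosure_iff.1 ‹IsNormalClosure K L E›).2
  have hle : IntermediateField.normalClosure K L E ≤
      IntermediateField.fixedField (galPerm K L E).ker := by
    refine normalClosure_le_iff.2 fun f => ?_
    rintro _ ⟨a, rfl⟩
    rw [IntermediateField.mem_fixedField_iff]
    intro h hh
    exact AlgHom.congr_fun (congrArg (fun π : Equiv.Perm (L →ₐ[K] E) => π f) hh) a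
  rw [htop] at hle
  ext e
  exact (IntermediateField.mem_fixedField_iff _ _).1 (hle (IntermediateField.mem_top (x := e))) g hg

lemma isNormalClosure_self_of_normal [Normal K L] : IsNormalClosure K L L :=
  Algebra.IsAlgebraic.isNormalClosure_iff.2 ⟨fun x => Normal.splits inferInstance x,
    top_le_iff.1 (le_trans (fun x _ => AlgHom.mem_fieldRange.2 ⟨x, rfl⟩)
      (AlgHom.fieldRange_le_normalClosure (AlgHom.id K L)))⟩

lemma isCyclic_gal_of_isNormalClosure [Normal K L] [IsNormalClosure K L E] [IsCyclic Gal(L/K)] :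
    IsCyclic Gal(E/K) := by
  have := isNormalClosure_self_of_normal (K := K) (L := L)
  let e : L ≃ₐ[K] E := IsNormalClosure.equiv (K := L)
  exact isCyclic_of_surjective (AlgEquiv.autCongr e) (AlgEquiv.autCongr e).surjective

end Main

theorem mainTheorem2 (p n : ℕ) (hp : p.Prime) (hp_odd : Odd p) (hn : 2 ≤ n)
    (K : Type u) (L : Type v) (E : Type w) [Field K] [Field L] [Field E]
    [Algebra K L] [Algebra K E] [Algebra.IsSeparable K L]
    (hdeg : Module.finrank K L = p ^ n) [IsNormalClosure K L E] :
    (IsGalois K L → IsCyclic Gal(L/K) →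
      HopfGaloisStructure.numberOfType K L E (Multiplicative (ZMod (p ^ n))) = p ^ (n - 1)) ∧
    (∀ (D : ℕ) (φ : Multiplicative (ZMod D) →* MulAut (Multiplicative (ZMod (p ^ n)))),
      1 < D → D ∣ p - 1 →
      Nonempty (Gal(E/K) ≃*
        Multiplicative (ZMod (p ^ n)) ⋊[φ] Multiplicative (ZMod D)) →
      HopfGaloisStructure.numberOfType K L E (Multiplicative (ZMod (p ^ n))) = 1) := by
  have : FiniteDimensional K L := Module.finite_of_finrank_pos (by
    rw [hdeg]; exact Nat.pos_of_ne_zero (pow_ne_zero _ hp.ne_zero))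
  have hX : Nat.card (L →ₐ[K] E) = p ^ n := by rw [card_algHom_of_isNormalClosure, hdeg]
  have hnum : HopfGaloisStructure.numberOfType K L E (Multiplicative (ZMod (p ^ n))) = _ :=
    HopfGaloisStructure.numberOfType_eq_ncard
  have := finiteDimensional_of_isNormalClosure (K := K) (L := L) (E := E)
  rw [hnum]
  constructor
  · intro _ _
    have := isCyclic_gal_of_isNormalClosure (K := K) (L := L) (E := E)
    obtain ⟨g, hg⟩ := IsCyclic.exists_monoid_generator (α := Gal(E/K))
    have hσ : ∀ x y, ∃ k : ℕ, ((galPerm K L E g) ^ k) x = y := by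
      intro x y
      obtain ⟨h, rfl⟩ := exists_comp_eq x y
      obtain ⟨k, rfl⟩ := (Submonoid.mem_powers_iff _ _).1 (hg h)
      exact ⟨k, by rw [map_pow]⟩
    rw [← ncard_isRegular_stable_of_cyclic hp hp_odd (by omega) hX hσ]
    congr 1
    ext P
    -- Stability under the generator `g` gives stability under all its powers.
    refine and_congr_right fun _ => and_congr_left fun _ => ⟨fun h => h g, fun h h' => ?_⟩
    obtain ⟨k, rfl⟩ := (Submonoid.mem_powers_iff _ _).1 (hg h')
    induction k with
    | zero => simp
    | succ k ih =>
      intro ν hν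
      have := h _ (ih ν hν)
      rw [pow_succ', map_mul, mul_inv_rev]
      simpa only [mul_assoc] using this
  · rintro D φ hD1 hD ⟨e⟩
    have hcop : D.Coprime p := Nat.Coprime.symm ((Nat.Prime.coprime_iff_not_dvd hp).2 fun h => by
      have h1 := hp.two_le
      have := Nat.le_of_dvd (by omega) (h.trans hD)
      omega)
    rw [← ncard_isRegular_stable_of_semidirectProduct
      ((galPerm K L E).comp e.symm.toMonoidHom) hp (by omega) hcop hD1 hX
      (fun x y => by
        obtain ⟨g, hg⟩ := exists_comp_eq x y
        exact ⟨e g, by simpa using! hg⟩)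
      (galPerm_injective.comp e.symm.injective)]
    congr 1
    ext P
    refine and_congr_right fun _ => and_congr_left fun _ => ⟨fun h γ => h (e.symm γ), fun h g => ?_⟩
    have := h (e g)
    simpa using! this
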